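/- Let $(\theta_j)_{j\ge1}$, $(\kappa_j)_{j\ge1}$ be sequences of nonnegative reals. For a permutation $\sigma\in S_N$ let $C_j=C_j(\sigma)$ be the number of cycles of length $j$ (fixed points are cycles of length $1$), and let $\mathbb P_N$ (with expectation $\mathbb E_N$) be the probability measure on $S_N$ given by $$\mathbb P_N(\sigma)=\frac1{N!\,H_N}\prod_{j=1}^N(\theta_j+N\kappa_j)^{C_j},\qquad H_N=\frac1{N!}\sum_{\sigma\in S_N}\prod_{j=1}^N(\theta_j+N\kappa_j)^{C_j}$$ (it is defined whenever $H_N>0$, which holds for all large $N$ under the assumptions below). Assume that $(\kappa_j)$ is non-arithmetic (no integer $d>1$ divides every $j$ with $\kappa_j\neq0$) and that $\kappa_j>0$ for some $j\ge2$. Put $g_\theta(z)=\sum_{j\ge1}\frac{\theta_j}{j}z^j$, $g_\kappa(z)=\sum_{j\ge1}\frac{\kappa_j}{j}z^j$, $g^{\{n\}}(z)=z^n\frac{d^n g}{dz^n}(z)$; let $R\in(0,\infty]$ be the radius of convergence of $g_\kappa$, and $g^{\{n\}}(R)=\lim_{r\uparrow R}g^{\{n\}}(r)\in[0,\infty]$.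 Assume that the radius of convergence of $g_\theta$ is at least $R$. For $R<\infty$, $\eta>0$, $\varphi\in(0,\pi/2)$ let $$\Delta_0=\{z\in\mathbb C:\ |z|<|R(1+\eta e^{i\varphi})|,\ z\ne R,\ |\arg(z-R)|>\varphi\};$$ below, "$g$ is holomorphic in $\Delta_0$" means that $g$ extends holomorphically from the disk $|z|<R$ to $\Delta_0$, and $O$-relations are for $z\to R$, $z\in\Delta_0$. Suppose that one of the following six conditions holds; in conditions 2–6, $R<\infty$, and $\delta>0$ is some constant. 1. (Subcritical) $1<g_\kappa^{\{1\}}(R)\le\infty$. 2. (Supercritical) $g_\kappa^{\{1\}}(R)<1$; for some $\eta,\varphi$, both $g_\theta$ and $g_\kappa$ are holomorphic in $\Delta_0$, $g_\theta(z)=-\theta^*\log(1-z/R)+O((1-z/R)^\delta)$ with some $\theta^*>0$, and $g_\kappa(z)=g_\kappa(R)-g_\kappa^{\{1\}}(R)(1-z/R)+O((1-z/R)^{1+\delta})$. 3. (Supercritical) $g_\kappa^{\{1\}}(R)<1$; for some $\eta,\varphi$, both $g_\theta$ and $g_\kappa$ are holomorphic in $\Delta_0$, $g_\theta$ is regular at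 $z=R$, and there are a non-integer $s>1$ and a real $a_s\ne0$ such that $g_\kappa^{\{n\}}(R)<\infty$ for $n<s$, $g_\kappa^{\{n\}}(R)=\infty$ for $n>s$, and $$g_\kappa(z)=\sum_{0\le n<s}\frac{(-1)^n g_\kappa^{\{n\}}(R)}{n!}(1-z/R)^n+a_s(1-z/R)^s+O((1-z/R)^{s+\delta}).$$ 4. (Critical) $g_\theta(R)<\infty$, $g_\kappa(R)<\infty$, $g_\kappa^{\{1\}}(R)=1$, $0<g_\kappa^{\{2\}}(R)<\infty$. 5. (Critical) $g_\kappa^{\{1\}}(R)=1$, $0<g_\kappa^{\{2\}}(R)<\infty$; for some $\eta,\varphi$, both $g_\theta$ and $g_\kappa$ are holomorphic in $\Delta_0$, $g_\theta(z)=-\theta^*\log(1-z/R)+O((1-z/R)^\delta)$ with some $\theta^*\ge0$, and $g_\kappa(z)=g_\kappa(R)-(1-z/R)+\frac12g_\kappa^{\{2\}}(R)(1-z/R)^2+O((1-z/R)^{2+\delta})$. 6. (Critical) $g_\kappa^{\{1\}}(R)=1$; for some $\eta,\varphi$, both $g_\theta$ and $g_\kappa$ are holomorphic in $\Delta_0$,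 $g_\theta(z)=-\theta^*\log(1-z/R)+O((1-z/R)^\delta)$ with some $\theta^*\ge0$, and $g_\kappa(z)=g_\kappa(R)-(1-z/R)+a_s(1-z/R)^s+O((1-z/R)^{s+\delta})$ with some $s\in(1,2)$, $a_s>0$. Then there is exactly one real number $r_*$ with $0<r_*\le R$ such that $g_\kappa^{\{1\}}(r_*)=1$ if $g_\kappa^{\{1\}}(R)\ge1$ and $r_*=R$ if $g_\kappa^{\{1\}}(R)\le1$. Writing $(x)_n=x(x-1)\cdots(x-n+1)$, $(x)_0=1$, the following hold. (a) For each $m$ and any integers $n_1,\dots,n_m\ge0$, $$\lim_{N\to\infty}N^{-(n_1+\dots+n_m)}\,\mathbb E_N\Bigl[\prod_{j=1}^m(C_j)_{n_j}\Bigr]=\prod_{j=1}^m\Bigl(\frac{\kappa_jr_*^j}{j}\Bigr)^{n_j}.$$ In particular, the random variables $C_j/N$ ($j\ge1$) are asymptotically independent and, for each $j\ge1$, $C_j/N\to\kappa_jr_*^j/j$ in probability as $N\to\infty$. (b) If $\kappa_j=0$ but $\theta_j>0$ for some $j\ge1$, then $\lim_{N\to\infty}\mathbb E_N[(C_j)_n]=(\theta_jr_*^j/j)^n$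 for every integer $n\ge0$, and $C_j$ converges weakly to the Poisson law with parameter $\theta_jr_*^j/j$. Asymptotic independence also holds when counts with $\kappa_j=0$ are not normalized: for every set $U\subseteq\{j\ge 1:\kappa_j=0\}$, the random variables $C_j$ ($j\in U$) and $C_j/N$ ($j\notin U$) are asymptotically independent. Here random variables $X_{N,j}$ ($j\ge1$) are called asymptotically independent if, for every finite set $J$ of indices and all bounded continuous $f_j:\mathbb R\to\mathbb R$ ($j\in J$), $\mathbb E_N[\prod_{j\in J}f_j(X_{N,j})]-\prod_{j\in J}\mathbb E_N[f_j(X_{N,j})]\to0$ as $N\to\infty$. -/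

import Mathlib

open Filter Topology Asymptotics ProbabilityTheory
open scoped ENNReal NNReal BoundedContinuousFunction

namespace SurrogateSpatial

noncomputable section

/-! ### The surrogate-spatial measure on permutations

The parameters are real sequences `θ j`, `κ j` with `j ≥ 1`; the value at `j = 0` is never used. -/

/-- `C_j(σ)`: the number of cycles of length `j` of `σ`, fixed points being cycles of length `1`. -/
def cycleCount {N : ℕ} (j : ℕ) (σ : Equiv.Perm (Fin N)) : ℕ :=
  σ.partition.parts.count j

/-- `∏_{j=1}^N (θ_j + N κ_j)^{C_j(σ)}`. -/
def cycleWeight (θ κ : ℕ → ℝ) (N : ℕ) (σ : Equiv.Perm (Fin N)) : ℝ :=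
  ∏ j ∈ Finset.Icc 1 N, (θ j + N * κ j) ^ cycleCount j σ

/-- The normalization constant `H_N`. -/
def normConst (θ κ : ℕ → ℝ) (N : ℕ) : ℝ :=
  (1 / (N.factorial : ℝ)) * ∑ σ : Equiv.Perm (Fin N), cycleWeight θ κ N σ

/-- The probability of the permutation `σ`. (If `H_N = 0` the measure does not exist, and this
is the zero function.) -/
def permProb (θ κ : ℕ → ℝ) (N : ℕ) (σ : Equiv.Perm (Fin N)) : ℝ :=
  cycleWeight θ κ N σ / (N.factorial * normConst θ κ N)

/-- The expectation of `X` with respect to the surrogate-spatial measure. -/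
def expect (θ κ : ℕ → ℝ) (N : ℕ) (X : Equiv.Perm (Fin N) → ℝ) : ℝ :=
  ∑ σ : Equiv.Perm (Fin N), permProb θ κ N σ * X σ

/-- The probability of the event `A` with respect to the surrogate-spatial measure. -/
def prob (θ κ : ℕ → ℝ) (N : ℕ) (A : Set (Equiv.Perm (Fin N))) : ℝ :=
  expect θ κ N (A.indicator fun _ => 1)

/-- Convergence in probability, as `N → ∞`, to a constant. -/
def TendstoInProb (θ κ : ℕ → ℝ) (X : (N : ℕ) → Equiv.Perm (Fin N) → ℝ) (c : ℝ) : Prop :=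
  ∀ ε : ℝ, 0 < ε → Tendsto (fun N => prob θ κ N {σ | ε ≤ |X N σ - c|}) atTop (𝓝 0)

/-- Weak convergence, as `N → ∞`, to the Poisson law with parameter `r`. -/
def TendstoPoisson (θ κ : ℕ → ℝ) (X : (N : ℕ) → Equiv.Perm (Fin N) → ℝ) (r : ℝ≥0) : Prop :=
  ∀ f : ℝ →ᵇ ℝ, Tendsto (fun N => expect θ κ N fun σ => f (X N σ)) atTop
    (𝓝 (∫ k : ℕ, f (k : ℝ) ∂poissonMeasure r))

/-- Asymptotic independence of the random variables `X N j`, `j ≥ 1`, as `N → ∞`: for any finite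
set of indices and any bounded continuous functions, the expectation of the product and the
product of the expectations differ by `o(1)`. -/
def AsympIndep (θ κ : ℕ → ℝ) (X : (N : ℕ) → ℕ → Equiv.Perm (Fin N) → ℝ) : Prop :=
  ∀ J : Finset ℕ, (∀ j ∈ J, 1 ≤ j) → ∀ f : ℕ → ℝ →ᵇ ℝ,
    Tendsto (fun N => expect θ κ N (fun σ => ∏ j ∈ J, f j (X N j σ)) -
      ∏ j ∈ J, expect θ κ N (fun σ => f j (X N j σ))) atTop (𝓝 0)

/-! ### Generating functions -/

/-- The generating function `g_a(z) = ∑_{j ≥ 1} (a_j / j) z^j` (the term `j = 0` is zero). -/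
def genFun (a : ℕ → ℝ) (z : ℂ) : ℂ := ∑' j : ℕ, ((a j / j : ℝ) : ℂ) * z ^ j

/-- The radius of convergence of `g_a`. -/
def radius (a : ℕ → ℝ) : ℝ≥0∞ :=
  (FormalMultilinearSeries.ofScalars ℂ fun j : ℕ => ((a j / j : ℝ) : ℂ)).radius

/-- The modified derivative `g_a^{n}(r) = r^n (d/dr)^n g_a(r)` of a generating function with
nonnegative coefficients at `r ∈ [0, R]`, as the (possibly divergent) series
`∑_j j (j-1) ⋯ (j-n+1) (a_j / j) r^j` of nonnegative terms. At `r = R` (also for `R = ∞`), this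
is the limit of the values as `r ↑ R`, by monotone convergence. -/
def modDeriv (a : ℕ → ℝ) (n : ℕ) (r : ℝ≥0∞) : ℝ≥0∞ :=
  ∑' j : ℕ, ENNReal.ofReal ((j.descFactorial n : ℝ) * (a j / j)) * r ^ j

/-- The sequence is non-arithmetic (no `d > 1` divides all `j` with `κ_j ≠ 0`) and non-degenerate
(`κ_j > 0` for some `j ≥ 2`). -/
structure NonArithmetic (κ : ℕ → ℝ) : Prop where
  nonArith : ¬ ∃ d : ℕ, 1 < d ∧ ∀ j : ℕ, 1 ≤ j → κ j ≠ 0 → d ∣ j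
  nondegenerate : ∃ j : ℕ, 2 ≤ j ∧ 0 < κ j

/-- `r` is the point `r_*`: the root of `g_κ^{1}(r) = 1` in `(0, R]` if `g_κ^{1}(R) ≥ 1`, and
`R` if `g_κ^{1}(R) ≤ 1`. -/
structure IsRStar (κ : ℕ → ℝ) (r : ℝ) : Prop where
  pos : 0 < r
  le_radius : ENNReal.ofReal r ≤ radius κ
  root : 1 ≤ modDeriv κ 1 (radius κ) → modDeriv κ 1 (ENNReal.ofReal r) = 1
  boundary : modDeriv κ 1 (radius κ) ≤ 1 → ENNReal.ofReal r = radius κ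

/-- The indented disk `Δ₀(R, η, φ)`. -/
def deltaDomain (R η φ : ℝ) : Set ℂ :=
  {z | ‖z‖ < ‖(R : ℂ) * (1 + η * Complex.exp (Complex.I * φ))‖ ∧ z ≠ R ∧
    φ < |Complex.arg (z - R)|}

/-- `G` is a holomorphic extension to `D` of the generating function `g_a`, whose series converges
for `|z| < R`. -/
structure Continues (a : ℕ → ℝ) (R : ℝ) (D : Set ℂ) (G : ℂ → ℂ) : Prop where
  le_radius : ENNReal.ofReal R ≤ radius a
  holo : DifferentiableOn ℂ G D
  eq_genFun : ∀ z : ℂ, ‖z‖ < R → G z = genFun a z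

/-- The value `g_κ^{n}(R)` as a real number (used only where it is finite). -/
def bdryVal (κ : ℕ → ℝ) (n : ℕ) (R : ℝ) : ℝ := (modDeriv κ n (ENNReal.ofReal R)).toReal

/-- `G(z) = -θ* log (1 - z/R) + O((1 - z/R)^δ)` as `z → R` in `D`. -/
def LogExpansion (R : ℝ) (D : Set ℂ) (G : ℂ → ℂ) (θs δ : ℝ) : Prop :=
  (fun z : ℂ => G z + θs * Complex.log (1 - z / R)) =O[𝓝[D] (R : ℂ)]
    fun z => ‖1 - z / R‖ ^ δ

/-! ### The asymptotic regimes -/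

/-- Subcritical case, `R ≤ ∞`. -/
def Subcritical (θ κ : ℕ → ℝ) : Prop :=
  0 < radius κ ∧ radius κ ≤ radius θ ∧ 1 < modDeriv κ 1 (radius κ)

/-- Supercritical case with a logarithmic singularity of `g_θ`. -/
def SupercriticalLog (θ κ : ℕ → ℝ) : Prop :=
  ∃ R η φ θs δ : ℝ, ∃ Gθ Gκ : ℂ → ℂ,
    0 < R ∧ radius κ = ENNReal.ofReal R ∧ 0 < η ∧ 0 < φ ∧ φ < Real.pi / 2 ∧
    0 < θs ∧ 0 < δ ∧
    modDeriv κ 1 (ENNReal.ofReal R) < 1 ∧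
    Continues θ R (deltaDomain R η φ) Gθ ∧
    Continues κ R (deltaDomain R η φ) Gκ ∧
    LogExpansion R (deltaDomain R η φ) Gθ θs δ ∧
    (fun z : ℂ => Gκ z - (bdryVal κ 0 R - bdryVal κ 1 R * (1 - z / R)))
      =O[𝓝[deltaDomain R η φ] (R : ℂ)] fun z => ‖1 - z / R‖ ^ (1 + δ)

/-- Supercritical case with `g_θ` regular at `R` and a power singularity of `g_κ`. -/
def SupercriticalPower (θ κ : ℕ → ℝ) : Prop :=
  ∃ R η φ s as δ : ℝ, ∃ Gθ Gκ : ℂ → ℂ,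
    0 < R ∧ radius κ = ENNReal.ofReal R ∧ 0 < η ∧ 0 < φ ∧ φ < Real.pi / 2 ∧
    1 < s ∧ (∀ n : ℕ, s ≠ n) ∧ as ≠ 0 ∧ 0 < δ ∧
    modDeriv κ 1 (ENNReal.ofReal R) < 1 ∧
    (∀ n : ℕ, (n : ℝ) < s → modDeriv κ n (ENNReal.ofReal R) < ∞) ∧
    (∀ n : ℕ, s < n → modDeriv κ n (ENNReal.ofReal R) = ∞) ∧
    Continues θ R (deltaDomain R η φ) Gθ ∧ AnalyticAt ℂ Gθ R ∧
    Continues κ R (deltaDomain R η φ) Gκ ∧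
    (fun z : ℂ => Gκ z - (∑ n ∈ Finset.range ⌈s⌉₊,
        (-1) ^ n * (bdryVal κ n R : ℂ) / (n.factorial : ℂ) * (1 - z / R) ^ n
        + as * (1 - z / R) ^ (s : ℂ)))
      =O[𝓝[deltaDomain R η φ] (R : ℂ)] fun z => ‖1 - z / R‖ ^ (s + δ)

/-- Critical case with `g_θ(R) < ∞` and `g_κ^{2}(R) < ∞`. -/
def CriticalRegular (θ κ : ℕ → ℝ) : Prop :=
  ∃ R : ℝ, 0 < R ∧ radius κ = ENNReal.ofReal R ∧ ENNReal.ofReal R ≤ radius θ ∧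
    modDeriv θ 0 (ENNReal.ofReal R) < ∞ ∧
    modDeriv κ 0 (ENNReal.ofReal R) < ∞ ∧
    modDeriv κ 1 (ENNReal.ofReal R) = 1 ∧
    0 < modDeriv κ 2 (ENNReal.ofReal R) ∧ modDeriv κ 2 (ENNReal.ofReal R) < ∞

/-- Critical case, `g_θ` possibly with a logarithmic singularity, `g_κ^{2}(R) < ∞`. -/
def CriticalLog (θ κ : ℕ → ℝ) : Prop :=
  ∃ R η φ θs δ : ℝ, ∃ Gθ Gκ : ℂ → ℂ,
    0 < R ∧ radius κ = ENNReal.ofReal R ∧ 0 < η ∧ 0 < φ ∧ φ < Real.pi / 2 ∧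
    0 ≤ θs ∧ 0 < δ ∧
    modDeriv κ 1 (ENNReal.ofReal R) = 1 ∧
    0 < modDeriv κ 2 (ENNReal.ofReal R) ∧ modDeriv κ 2 (ENNReal.ofReal R) < ∞ ∧
    Continues θ R (deltaDomain R η φ) Gθ ∧
    Continues κ R (deltaDomain R η φ) Gκ ∧
    LogExpansion R (deltaDomain R η φ) Gθ θs δ ∧
    (fun z : ℂ => Gκ z - (bdryVal κ 0 R - (1 - z / R)
        + bdryVal κ 2 R / 2 * (1 - z / R) ^ 2))
      =O[𝓝[deltaDomain R η φ] (R : ℂ)] fun z => ‖1 - z / R‖ ^ (2 + δ)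

/-- Critical case, `g_θ` possibly with a logarithmic singularity, `g_κ` with a power singularity
of order `s ∈ (1, 2)`. -/
def CriticalPower (θ κ : ℕ → ℝ) : Prop :=
  ∃ R η φ θs s as δ : ℝ, ∃ Gθ Gκ : ℂ → ℂ,
    0 < R ∧ radius κ = ENNReal.ofReal R ∧ 0 < η ∧ 0 < φ ∧ φ < Real.pi / 2 ∧
    0 ≤ θs ∧ 1 < s ∧ s < 2 ∧ 0 < as ∧ 0 < δ ∧
    modDeriv κ 1 (ENNReal.ofReal R) = 1 ∧
    Continues θ R (deltaDomain R η φ) Gθ ∧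
    Continues κ R (deltaDomain R η φ) Gκ ∧
    LogExpansion R (deltaDomain R η φ) Gθ θs δ ∧
    (fun z : ℂ => Gκ z - (bdryVal κ 0 R - (1 - z / R) + as * (1 - z / R) ^ (s : ℂ)))
      =O[𝓝[deltaDomain R η φ] (R : ℂ)] fun z => ‖1 - z / R‖ ^ (s + δ)

/-- The standing assumption on the generating functions: one of the six regimes. -/
def Admissible (θ κ : ℕ → ℝ) : Prop :=
  Subcritical θ κ ∨ SupercriticalLog θ κ ∨ SupercriticalPower θ κ ∨
    CriticalRegular θ κ ∨ CriticalLog θ κ ∨ CriticalPower θ κ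

end

end SurrogateSpatial

/-! Grouping permutations by cycle type turns the measure into a weight on partitions: `H_N` becomes
`Z_N`, where `Z_M = partSum (cycleParam θ κ N) M` and the parameters `x_j = (θ_j + N κ_j) / j`
depend on `N`. Removing `n_j` parts of each size `j` shows that a joint factorial moment equals `∏
x_j ^ n_j` times the ratio of `Z_{N - ∑ n_j j}` to `Z_N` (`expect_prod_descFactorial`). Everything
thus rests on `Z_{N-i} / Z_N → r_* ^ i` (`SaddlePoint.tendsto_partSum_ratio`).

The ratio is found by large deviations, in one argument for all six regimes. With `g = g_κ(r_*)`, a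
Chernoff bound at `ρ < r_*` gives `Z_N ρ^N ≤ exp (N g + O(1))`, also when `x_i` is multiplied by
`e^t`, at a known extra cost (`partSum_update_le`). In the other direction, `Z_{N-k} r_*^{N-k} ≥ exp
(N (g - ε))` for large `N` (`eventually_exp_le_partSum_sub`): about `N κ_j r_*^j / j` parts of each
size `j` have total size near `m N` with `m = g_κ^{1}(r_*) ≤ 1`, and the missing `(1 - m) N` is
filled by parts of a single size. Filling is nearly free because either `m = 1`, or `r_* = R` and
`κ_j R^j` does not decay exponentially. Comparing both bounds through Jensen's inequality, for small
`t` of either sign, gives `E[C_i] / N → κ_i r_*^i / i` (`tendsto_mean`). Since `E[C_i] = x_i Z_{N-i}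
/ Z_N`, the ratio limit follows for `κ_i > 0`. It is multiplicative in `i`, and the support of `κ`
has gcd 1, hence generates all large integers; so it holds for every `i`.

The first two factorial moments then give `C_j / N → κ_j r_*^j / j` in probability. For `κ_j = 0`
the parameters do not grow, so joint factorial moments converge to those of independent Poisson
variables; Newton interpolation of bounded functions upgrades this to weak convergence
(`hasPoissonMeans_of_bounded`). Asymptotic independence combines a Poisson factor with factors that
tend to constants. -/

namespace SurrogateSpatial

/-! ### Weighted sums over partitions -/

/-- The weight `∏_j x_j^{c_j} / c_j!` of a multiset in which `j` occurs `c_j` times. -/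
noncomputable def partWeight (x : ℕ → ℝ) (s : Multiset ℕ) : ℝ :=
  ∏ j ∈ s.toFinset, x j ^ s.count j / ((s.count j).factorial : ℝ)

/-- The sum of the weights of all partitions of `M`. -/
noncomputable def partSum (x : ℕ → ℝ) (M : ℕ) : ℝ :=
  ∑ p : M.Partition, partWeight x p.parts

lemma partWeight_eq_prod (x : ℕ → ℝ) {s : Multiset ℕ} {T : Finset ℕ} (h : s.toFinset ⊆ T) :
    partWeight x s = ∏ j ∈ T, x j ^ s.count j / ((s.count j).factorial : ℝ) := by
  refine Finset.prod_subset h fun j _ hj => ?_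
  rw [Multiset.mem_toFinset] at hj
  simp [Multiset.count_eq_zero_of_notMem hj]

lemma partWeight_nonneg {x : ℕ → ℝ} (hx : ∀ j, 0 ≤ x j) (s : Multiset ℕ) :
    0 ≤ partWeight x s :=
  Finset.prod_nonneg fun j _ => div_nonneg (pow_nonneg (hx j) _) (Nat.cast_nonneg _)

lemma partSum_nonneg {x : ℕ → ℝ} (hx : ∀ j, 0 ≤ x j) (M : ℕ) : 0 ≤ partSum x M :=
  Finset.sum_nonneg fun p _ => partWeight_nonneg hx p.parts

lemma partWeight_le_partSum {x : ℕ → ℝ} (hx : ∀ j, 0 ≤ x j) {M : ℕ} (p : M.Partition) :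
    partWeight x p.parts ≤ partSum x M :=
  Finset.single_le_sum (f := fun p : M.Partition => partWeight x p.parts)
    (fun p _ => partWeight_nonneg hx p.parts) (Finset.mem_univ p)

lemma partition_toFinset_subset {M : ℕ} (p : M.Partition) :
    p.parts.toFinset ⊆ Finset.Icc 1 M := fun j hj => by
  rw [Multiset.mem_toFinset] at hj
  exact Finset.mem_Icc.2 ⟨p.parts_pos hj, p.le_of_mem_parts hj⟩

lemma count_mul_le {M : ℕ} (p : M.Partition) (j : ℕ) : p.parts.count j * j ≤ M := by
  obtain ⟨u, hu⟩ := Multiset.le_iff_exists_add.1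
    (Multiset.le_count_iff_replicate_le.1 (le_refl (p.parts.count j)))
  have h := congrArg Multiset.sum hu
  rw [p.parts_sum, Multiset.sum_add, Multiset.sum_replicate, smul_eq_mul] at h
  omega

/-- Scaling the parameters by `r^j` scales the weight by `r` to the size. -/
lemma partWeight_mul_pow (x : ℕ → ℝ) (r : ℝ) {M : ℕ} (p : M.Partition) :
    partWeight (fun j => x j * r ^ j) p.parts = partWeight x p.parts * r ^ M := by
  have h : r ^ M = ∏ j ∈ p.parts.toFinset, r ^ (p.parts.count j * j) := by
    rw [Finset.prod_pow_eq_pow_sum]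
    congr 1
    conv_lhs => rw [← p.parts_sum, Finset.sum_multiset_count]
    simp
  rw [h, partWeight, partWeight, ← Finset.prod_mul_distrib]
  refine Finset.prod_congr rfl fun j _ => ?_
  rw [mul_pow, ← pow_mul, mul_comm j]
  ring

lemma partSum_mul_pow (x : ℕ → ℝ) (r : ℝ) (M : ℕ) :
    partSum (fun j => x j * r ^ j) M = partSum x M * r ^ M := by
  simp_rw [partSum, partWeight_mul_pow, Finset.sum_mul]

/-- Exponential tilting of one multiplicity. -/
lemma sum_partWeight_mul_pow_count (x : ℕ → ℝ) (a : ℝ) (i M : ℕ) :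
    ∑ p : M.Partition, partWeight x p.parts * a ^ p.parts.count i =
      partSum (Function.update x i (x i * a)) M := by
  refine Finset.sum_congr rfl fun p _ => ?_
  have hs : p.parts.toFinset ⊆ insert i p.parts.toFinset := Finset.subset_insert _ _
  rw [partWeight_eq_prod _ hs, partWeight_eq_prod _ hs,
    ← Finset.mul_prod_erase _ _ (Finset.mem_insert_self i _),
    ← Finset.mul_prod_erase _ _ (Finset.mem_insert_self i _), Function.update_self, mul_pow]
  rw [Finset.prod_congr rfl (g := fun j => Function.update x i (x i * a) j ^ p.parts.count j /
    ((p.parts.count j).factorial : ℝ))]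
  · ring
  · intro j hj
    rw [Function.update_of_ne (Finset.ne_of_mem_erase hj)]

/-- Chernoff bound for sums over partitions. -/
lemma partSum_le_exp {x : ℕ → ℝ} (hx : ∀ j, 0 ≤ x j) (M : ℕ) :
    partSum x M ≤ Real.exp (∑ j ∈ Finset.Icc 1 M, x j) := by
  classical
  rw [Real.exp_sum]
  have h1 : ∏ j ∈ Finset.Icc 1 M, ∑ c ∈ Finset.range (M + 1), x j ^ c / (c.factorial : ℝ) ≤
      ∏ j ∈ Finset.Icc 1 M, Real.exp (x j) :=
    Finset.prod_le_prod
      (fun j _ => Finset.sum_nonneg fun c _ => div_nonneg (pow_nonneg (hx j) _) (Nat.cast_nonneg _))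
      fun j _ => Real.sum_le_exp_of_nonneg (hx j) _
  refine le_trans ?_ h1
  rw [Finset.prod_sum, partSum]
  -- A partition is determined by its multiplicities, all at most `M`, so the sum is part of the
  -- expanded product of truncated exponential series.
  let e : M.Partition → ∀ j ∈ Finset.Icc 1 M, ℕ := fun p j _ => p.parts.count j
  have he : Function.Injective e := fun p q h => by
    refine Nat.Partition.ext (Multiset.ext.2 fun j => ?_)
    by_cases hj : j ∈ Finset.Icc 1 M
    · exact congrFun (congrFun h j) hj
    · rw [Multiset.count_eq_zero_of_notMem fun h => hj (partition_toFinset_subset p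
        (Multiset.mem_toFinset.2 h)), Multiset.count_eq_zero_of_notMem fun h => hj
        (partition_toFinset_subset q (Multiset.mem_toFinset.2 h))]
  have hsum : ∑ p : M.Partition, partWeight x p.parts =
      ∑ c ∈ Finset.univ.image e, ∏ j ∈ (Finset.Icc 1 M).attach,
        x j ^ c j j.2 / ((c j j.2).factorial : ℝ) := by
    rw [Finset.sum_image fun p _ q _ h => he h]
    refine Finset.sum_congr rfl fun p _ => ?_
    rw [partWeight_eq_prod x (partition_toFinset_subset p), ← Finset.prod_attach]
  rw [hsum]
  refine Finset.sum_le_sum_of_subset_of_nonneg ?_ fun c _ _ =>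
    Finset.prod_nonneg fun j _ => div_nonneg (pow_nonneg (hx j) _) (Nat.cast_nonneg _)
  intro c hc
  obtain ⟨p, -, rfl⟩ := Finset.mem_image.1 hc
  refine Finset.mem_pi.2 fun j hj => Finset.mem_range_succ_iff.2 ?_
  exact (Nat.le_mul_of_pos_right _ (Finset.mem_Icc.1 hj).1).trans (count_mul_le p j)

/-- Factorial moments of multiplicities of partitions. -/
lemma sum_partWeight_mul_descFactorial (x : ℕ → ℝ) (T : Finset ℕ) (hT : ∀ j ∈ T, 1 ≤ j)
    (n : ℕ → ℕ) {M L : ℕ} (hL : L = M + ∑ j ∈ T, n j * j) :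
    ∑ p : L.Partition, partWeight x p.parts *
        ∏ j ∈ T, ((p.parts.count j).descFactorial (n j) : ℝ) =
      (∏ j ∈ T, x j ^ n j) * partSum x M := by
  classical
  subst hL
  set m : Multiset ℕ := ∑ j ∈ T, Multiset.replicate (n j) j with hm
  have hms : m.sum = ∑ j ∈ T, n j * j := by
    simp [hm, Multiset.sum_sum]
  have hmc : ∀ i, m.count i = if i ∈ T then n i else 0 := fun i => by
    simp [hm, Multiset.count_sum', Multiset.count_replicate]
  have hmpos : ∀ {i}, i ∈ m → 0 < i := fun {i} hi => by
    rw [← Multiset.count_pos, hmc] at hi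
    split_ifs at hi with h
    · exact hT i h
    · exact absurd hi (lt_irrefl _)
  -- Adding the parts of `m` is injective, with image the partitions having at least `n j` parts of
  -- each size `j ∈ T`. Off the image some falling factorial vanishes; on it, `(c + n)_n / (c + n)!
  -- = 1 / c!`.
  let e : M.Partition → (M + ∑ j ∈ T, n j * j).Partition := fun p =>
    ⟨p.parts + m, fun {i} hi => (Multiset.mem_add.1 hi).elim (fun h => p.parts_pos h) hmpos, by
      rw [Multiset.sum_add, p.parts_sum, hms]⟩
  have he : Function.Injective e := fun p q h => by
    have := congrArg Nat.Partition.parts h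
    exact Nat.Partition.ext (by simpa [e] using this)
  rw [partSum, Finset.mul_sum, ← Finset.sum_subset (Finset.subset_univ (Finset.univ.image e)),
    Finset.sum_image fun p _ q _ h => he h]
  · refine Finset.sum_congr rfl fun p _ => ?_
    have h1 : (e p).parts.toFinset ⊆ (p.parts + m).toFinset ∪ T := Finset.subset_union_left
    have h2 : p.parts.toFinset ⊆ (p.parts + m).toFinset ∪ T := by
      rw [Multiset.toFinset_add]
      exact Finset.subset_union_left.trans Finset.subset_union_left
    have h3 : T ⊆ (p.parts + m).toFinset ∪ T := Finset.subset_union_right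
    rw [partWeight_eq_prod x h1, partWeight_eq_prod x h2]
    have h4 : ∀ f : ℕ → ℝ, ∏ j ∈ T, f j =
        ∏ j ∈ (p.parts + m).toFinset ∪ T, if j ∈ T then f j else 1 := fun f => by
      rw [Finset.prod_ite_mem, Finset.inter_eq_right.2 h3]
    rw [h4, h4, ← Finset.prod_mul_distrib, ← Finset.prod_mul_distrib]
    refine Finset.prod_congr rfl fun j _ => ?_
    simp only [e, Multiset.count_add, hmc]
    split_ifs with hj
    · rw [← Nat.factorial_mul_descFactorial (Nat.le_add_left (n j) (p.parts.count j)),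
        Nat.add_sub_cancel, pow_add]
      have a1 : ((p.parts.count j).factorial : ℝ) ≠ 0 := by positivity
      have a2 : (((p.parts.count j + n j).descFactorial (n j) : ℕ) : ℝ) ≠ 0 := by
        rw [Nat.cast_ne_zero, Ne, Nat.descFactorial_eq_zero_iff_lt]; omega
      push_cast
      field_simp
    · simp
  · intro p _ hp
    by_cases h : ∀ j ∈ T, n j ≤ p.parts.count j
    · exfalso
      apply hp
      have hle : m ≤ p.parts := by
        rw [Multiset.le_iff_count]
        intro j
        rw [hmc]
        split_ifs with hj
        · exact h j hj
        · exact Nat.zero_le _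
      refine Finset.mem_image.2 ⟨⟨p.parts - m, fun {i} hi =>
        p.parts_pos (Multiset.mem_of_le (Multiset.sub_le_self _ _) hi), ?_⟩, Finset.mem_univ _, ?_⟩
      · have := congrArg Multiset.sum (Multiset.sub_add_cancel hle)
        rw [Multiset.sum_add, p.parts_sum, hms] at this
        omega
      · exact Nat.Partition.ext (Multiset.sub_add_cancel hle)
    · push Not at h
      obtain ⟨j, hj, hlt⟩ := h
      rw [Finset.prod_eq_zero hj (by rw [Nat.descFactorial_of_lt hlt, Nat.cast_zero]), mul_zero]

/-- Adding one part of size `j` to a partition. -/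
lemma le_mul_partSum_add {x : ℕ → ℝ} (hx : ∀ j, 0 ≤ x j) {j : ℕ} (hj : 1 ≤ j) (M : ℕ) :
    j * x j * partSum x M ≤ (M + j : ℕ) * partSum x (M + j) := by
  have h := sum_partWeight_mul_descFactorial x {j} (by simpa using hj) (fun _ => 1)
    (M := M) (L := M + j) (by simp)
  simp only [Finset.prod_singleton, Nat.descFactorial_one, pow_one] at h
  rw [mul_assoc, ← h, partSum, Finset.mul_sum, Finset.mul_sum]
  refine Finset.sum_le_sum fun p _ => ?_
  have h1 := count_mul_le p j
  have h2 : (p.parts.count j : ℝ) * j ≤ (M + j : ℕ) := by exact_mod_cast h1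
  calc (j : ℝ) * (partWeight x p.parts * p.parts.count j)
      = (p.parts.count j * j) * partWeight x p.parts := by ring
    _ ≤ _ := mul_le_mul_of_nonneg_right h2 (partWeight_nonneg hx _)

/-! ### From permutations to partitions -/

/-- A cycle type lists only parts of size at least 2, whereas a partition also records fixed points
as parts 1. The larger parts determine how many 1s there are, which lets the count of permutations
by cycle type be transferred. -/
lemma partition_parts_eq {N : ℕ} (p : N.Partition) :
    p.parts = p.parts.filter (2 ≤ ·) +
      Multiset.replicate (N - (p.parts.filter (2 ≤ ·)).sum) 1 := by
  have h1 : p.parts.filter (fun n => ¬ 2 ≤ n) =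
      Multiset.replicate (p.parts.filter (fun n => ¬ 2 ≤ n)).card 1 := by
    refine Multiset.eq_replicate_card.2 fun b hb => ?_
    rw [Multiset.mem_filter] at hb
    have := p.parts_pos hb.1
    omega
  have h2 := Multiset.filter_add_not (2 ≤ ·) p.parts
  have h3 := congrArg Multiset.sum h2
  rw [Multiset.sum_add, p.parts_sum, h1, Multiset.sum_replicate, smul_eq_mul, mul_one] at h3
  conv_lhs => rw [← h2, h1]
  congr 2
  omega

/-- The number of permutations with given partition. -/
lemma card_partition_parts {N : ℕ} (p : N.Partition) :
    (((Finset.univ.filter fun σ : Equiv.Perm (Fin N) => σ.partition.parts = p.parts).card : ℕ) : ℝ)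
      = N.factorial * partWeight (fun j => 1 / (j : ℝ)) p.parts := by
  set m := p.parts.filter (2 ≤ ·) with hm
  have hp := partition_parts_eq p
  rw [← hm] at hp
  have hmN : m.sum ≤ N := by
    have h := congrArg Multiset.sum hp
    rw [p.parts_sum, Multiset.sum_add] at h
    omega
  have hset : (Finset.univ.filter fun σ : Equiv.Perm (Fin N) => σ.partition.parts = p.parts) =
      Finset.univ.filter fun σ : Equiv.Perm (Fin N) => σ.cycleType = m := by
    refine Finset.filter_congr fun σ _ => ⟨fun h => ?_, fun h => ?_⟩
    · rw [← Equiv.Perm.filter_parts_partition_eq_cycleType, h]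
    · rw [Equiv.Perm.parts_partition, ← Equiv.Perm.sum_cycleType, h, hp, Fintype.card_fin]
  have hcard := Equiv.Perm.card_of_cycleType_mul_eq (Fin N) m
  rw [Fintype.card_fin, if_pos ⟨hmN, fun a ha => (Multiset.mem_filter.1 ha).2⟩, ← hset] at hcard
  have h1m : 1 ∉ m.toFinset := by simp [hm]
  have hsub : p.parts.toFinset ⊆ insert 1 m.toFinset := by
    intro j hj
    rw [Multiset.mem_toFinset, hp, Multiset.mem_add] at hj
    rcases hj with hj | hj
    · exact Finset.mem_insert_of_mem (Multiset.mem_toFinset.2 hj)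
    · rw [Multiset.eq_of_mem_replicate hj]
      exact Finset.mem_insert_self _ _
  have hc1 : p.parts.count 1 = N - m.sum := by
    rw [Multiset.mem_toFinset] at h1m
    rw [hp, Multiset.count_add, Multiset.count_eq_zero_of_notMem h1m, Multiset.count_replicate_self,
      zero_add]
  have hcj : ∀ j ∈ m.toFinset, p.parts.count j = m.count j := fun j hj => by
    have : j ≠ 1 := fun h => h1m (h ▸ hj)
    conv_lhs => rw [hp]
    rw [Multiset.count_add, Multiset.count_replicate, if_neg this.symm, add_zero]
  -- The weight is the reciprocal of the denominator in Cauchy's formula for the number of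
  -- permutations of given cycle type.
  have hw : partWeight (fun j => 1 / (j : ℝ)) p.parts *
      (((N - m.sum).factorial * m.prod * ∏ n ∈ m.toFinset, (m.count n).factorial : ℕ) : ℝ) = 1 := by
    rw [partWeight_eq_prod _ hsub, Finset.prod_insert h1m, hc1, Finset.prod_multiset_count m]
    push_cast
    have : ∀ a b c d e : ℝ, a * b * (c * d * e) = (a * c) * (b * (d * e)) :=
      fun a b c d e => by ring
    rw [this, ← Finset.prod_mul_distrib, ← Finset.prod_mul_distrib, Finset.prod_eq_one, mul_one]
    · have : ((N - m.sum).factorial : ℝ) ≠ 0 := by positivity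
      rw [div_one, one_pow]
      field_simp
    · intro j hj
      have h2 : 2 ≤ j := (Multiset.mem_filter.1 (Multiset.mem_toFinset.1 hj)).2
      have : (j : ℝ) ≠ 0 := by norm_cast; omega
      rw [hcj j hj]
      have : ((m.count j).factorial : ℝ) ≠ 0 := by positivity
      rw [div_pow, one_pow]
      field_simp
  rw [← hcard, Nat.cast_mul]
  linear_combination (-((Finset.univ.filter fun σ : Equiv.Perm (Fin N) =>
    σ.partition.parts = p.parts).card : ℝ)) * hw

/-- The parameters `(θ_j + N κ_j) / j` of the partition sums. -/
noncomputable def cycleParam (θ κ : ℕ → ℝ) (N j : ℕ) : ℝ := (θ j + N * κ j) / j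

lemma sum_cycleWeight_mul (θ κ : ℕ → ℝ) (N : ℕ) (F : Multiset ℕ → ℝ) :
    ∑ σ : Equiv.Perm (Fin N), cycleWeight θ κ N σ * F σ.partition.parts =
      N.factorial * ∑ p : N.Partition, partWeight (cycleParam θ κ N) p.parts * F p.parts := by
  classical
  let q : Equiv.Perm (Fin N) → N.Partition := fun σ =>
    ⟨σ.partition.parts, fun h => σ.partition.parts_pos h, by
      rw [σ.partition.parts_sum, Fintype.card_fin]⟩
  have hq : ∀ σ p, q σ = p ↔ σ.partition.parts = p.parts := fun σ p => Nat.Partition.ext_iff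
  rw [← Finset.sum_fiberwise Finset.univ q, Finset.mul_sum]
  refine Finset.sum_congr rfl fun p _ => ?_
  have : ∀ σ ∈ Finset.univ.filter (fun σ => q σ = p), cycleWeight θ κ N σ * F σ.partition.parts =
      (∏ j ∈ Finset.Icc 1 N, (θ j + N * κ j) ^ p.parts.count j) * F p.parts := by
    intro σ hσ
    rw [Finset.mem_filter, hq] at hσ
    simp only [cycleWeight, cycleCount, hσ.2]
  rw [Finset.sum_congr rfl this, Finset.sum_const, nsmul_eq_mul]
  simp_rw [hq]
  rw [card_partition_parts, partWeight_eq_prod _ (partition_toFinset_subset p),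
    partWeight_eq_prod _ (partition_toFinset_subset p)]
  have : ∏ j ∈ Finset.Icc 1 N, cycleParam θ κ N j ^ p.parts.count j /
      ((p.parts.count j).factorial : ℝ) =
      (∏ j ∈ Finset.Icc 1 N, (1 / (j : ℝ)) ^ p.parts.count j / ((p.parts.count j).factorial : ℝ)) *
      ∏ j ∈ Finset.Icc 1 N, (θ j + N * κ j) ^ p.parts.count j := by
    rw [← Finset.prod_mul_distrib]
    refine Finset.prod_congr rfl fun j _ => ?_
    rw [cycleParam, div_pow, div_pow, one_pow]
    ring
  rw [this]
  ring

lemma normConst_eq (θ κ : ℕ → ℝ) (N : ℕ) :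
    normConst θ κ N = partSum (cycleParam θ κ N) N := by
  have h := sum_cycleWeight_mul θ κ N fun _ => 1
  simp only [mul_one] at h
  rw [normConst, h, partSum]
  field_simp

lemma expect_eq (θ κ : ℕ → ℝ) (N : ℕ) (F : Multiset ℕ → ℝ) :
    expect θ κ N (fun σ => F σ.partition.parts) =
      (∑ p : N.Partition, partWeight (cycleParam θ κ N) p.parts * F p.parts) /
        partSum (cycleParam θ κ N) N := by
  have h := sum_cycleWeight_mul θ κ N F
  have : ∀ σ : Equiv.Perm (Fin N), permProb θ κ N σ * F σ.partition.parts =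
      (cycleWeight θ κ N σ * F σ.partition.parts) / (N.factorial * normConst θ κ N) :=
    fun σ => by rw [permProb]; ring
  simp_rw [expect, this]
  rw [← Finset.sum_div, h, normConst_eq]
  have : (N.factorial : ℝ) ≠ 0 := by positivity
  rw [mul_div_mul_left _ _ this]

/-- Joint factorial moments of cycle counts. -/
lemma expect_prod_descFactorial (θ κ : ℕ → ℝ) (T : Finset ℕ) (hT : ∀ j ∈ T, 1 ≤ j)
    (n : ℕ → ℕ) (N : ℕ) (hN : ∑ j ∈ T, n j * j ≤ N) :
    expect θ κ N (fun σ => ∏ j ∈ T, ((cycleCount j σ).descFactorial (n j) : ℝ)) =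
      (∏ j ∈ T, cycleParam θ κ N j ^ n j) *
        (partSum (cycleParam θ κ N) (N - ∑ j ∈ T, n j * j) / partSum (cycleParam θ κ N) N) := by
  have h := expect_eq θ κ N fun s => ∏ j ∈ T, ((s.count j).descFactorial (n j) : ℝ)
  unfold cycleCount
  rw [h, ← mul_div_assoc]
  congr 1
  obtain ⟨M, rfl⟩ := Nat.exists_eq_add_of_le' hN
  rw [Nat.add_sub_cancel]
  exact sum_partWeight_mul_descFactorial _ T hT n rfl

/-! ### An exponential lower bound for partition sums -/

/-- The parameters `x` are nonnegative and at least `N b_j / j`. -/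
structure Dominates (b : ℕ → ℝ) (N : ℕ) (x : ℕ → ℝ) : Prop where
  nonneg : ∀ j, 0 ≤ x j
  le : ∀ j, N * (b j / j) ≤ x j

/-- The factor gained by adding a part is `j x_j / (M + j)`, which is at least `N b_j / (M + j) ≥
b_j` because the size stays at most `N`. So adding a part costs a constant independent of `N`. -/
lemma Dominates.partSum_add {b : ℕ → ℝ} {N : ℕ} {x : ℕ → ℝ} (h : Dominates b N x) {j : ℕ}
    (hj : 1 ≤ j) {M : ℕ} (hM : M + j ≤ N) : b j * partSum x M ≤ partSum x (M + j) := by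
  have h1 := le_mul_partSum_add h.nonneg hj M
  have h2 := h.le j
  have hj0 : (0 : ℝ) < j := by exact_mod_cast hj
  have hN : (0 : ℝ) < N := by norm_cast; omega
  have h3 : N * b j ≤ j * x j := by
    have := mul_le_mul_of_nonneg_left h2 hj0.le
    calc N * b j = j * (N * (b j / j)) := by field_simp
      _ ≤ _ := this
  have h4 : ((M + j : ℕ) : ℝ) ≤ N := by exact_mod_cast hM
  have h5 := mul_le_mul_of_nonneg_right h3 (partSum_nonneg h.nonneg M)
  have h6 := mul_le_mul_of_nonneg_right h4 (partSum_nonneg h.nonneg (M + j))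
  refine le_of_mul_le_mul_left ?_ hN
  linarith

lemma Dominates.partSum_add_mul {b : ℕ → ℝ} {N : ℕ} {x : ℕ → ℝ} (h : Dominates b N x) {j : ℕ}
    (hj : 1 ≤ j) (hb : 0 ≤ b j) {M : ℕ} (q : ℕ) (hM : M + q * j ≤ N) :
    b j ^ q * partSum x M ≤ partSum x (M + q * j) := by
  induction q with
  | zero => simp
  | succ q ih =>
    rw [add_mul, one_mul, ← add_assoc] at hM ⊢
    have h1 := h.partSum_add hj hM
    have h2 := mul_le_mul_of_nonneg_left (ih (by omega)) hb
    rw [pow_succ', mul_assoc]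
    exact h2.trans h1

/-- A size in the semigroup generated by the support of `b` is reached by finitely many parts. The
constant depends only on `s`, not on `N`, `x` or `M`. -/
lemma exists_const_partSum_add {b : ℕ → ℝ} {s : ℕ}
    (hs : s ∈ AddSubmonoid.closure {j : ℕ | 1 ≤ j ∧ 0 < b j}) :
    ∃ c : ℝ, 0 < c ∧ ∀ (N : ℕ) (x : ℕ → ℝ), Dominates b N x → ∀ M, M + s ≤ N →
      c * partSum x M ≤ partSum x (M + s) := by
  induction hs using AddSubmonoid.closure_induction with
  | mem j hj => exact ⟨b j, hj.2, fun N x hx M hM => hx.partSum_add hj.1 hM⟩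
  | zero => exact ⟨1, one_pos, fun N x hx M hM => by simp⟩
  | add s t _ _ hs ht =>
    obtain ⟨c, hc, h1⟩ := hs
    obtain ⟨d, hd, h2⟩ := ht
    refine ⟨d * c, mul_pos hd hc, fun N x hx M hM => ?_⟩
    rw [mul_assoc, ← add_assoc]
    exact (mul_le_mul_of_nonneg_left (h1 N x hx M (by omega)) hd.le).trans
      (h2 N x hx (M + s) (by omega))

/-- A one-sided Stirling estimate. The induction step is `(1 + 1/(n+1))^(n+2) ≥ e`, obtained from `1
- u ≤ e^(-u)` at `u = 1/(n+2)`. -/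
lemma factorial_mul_exp_le (n : ℕ) :
    (n.factorial : ℝ) * Real.exp n ≤ ((n : ℝ) + 1) ^ (n + 1) := by
  induction n with
  | zero => simp
  | succ n ih =>
    have h1 : Real.exp 1 * ((n : ℝ) + 1) ^ (n + 2) ≤ ((n : ℝ) + 1 + 1) ^ (n + 2) := by
      have hn : (0 : ℝ) < (n : ℝ) + 1 := by positivity
      have h2 : (n : ℝ) + 1 ≤ ((n : ℝ) + 1 + 1) * Real.exp (-(1 / ((n : ℝ) + 2))) := by
        have h3 := Real.add_one_le_exp (-(1 / ((n : ℝ) + 2)))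
        have h4 : (n : ℝ) + 1 = ((n : ℝ) + 1 + 1) * (-(1 / ((n : ℝ) + 2)) + 1) := by
          field_simp; ring
        refine h4.le.trans (mul_le_mul_of_nonneg_left h3 (by positivity))
      have h5 := pow_le_pow_left₀ hn.le h2 (n + 2)
      rw [mul_pow, ← Real.exp_nat_mul] at h5
      have h6 : ((n + 2 : ℕ) : ℝ) * -(1 / ((n : ℝ) + 2)) = -1 := by
        push_cast; field_simp
      rw [h6] at h5
      calc Real.exp 1 * ((n : ℝ) + 1) ^ (n + 2)
          ≤ Real.exp 1 * (((n : ℝ) + 1 + 1) ^ (n + 2) * Real.exp (-1)) :=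
            mul_le_mul_of_nonneg_left h5 (Real.exp_pos _).le
        _ = _ := by rw [mul_comm _ (Real.exp (-1)), ← mul_assoc, ← Real.exp_add]; simp
    push_cast [Nat.factorial_succ]
    rw [Real.exp_add]
    calc ((n : ℝ) + 1) * n.factorial * (Real.exp n * Real.exp 1)
        = (Real.exp 1 * ((n : ℝ) + 1)) * (n.factorial * Real.exp n) := by ring
      _ ≤ (Real.exp 1 * ((n : ℝ) + 1)) * ((n : ℝ) + 1) ^ (n + 1) :=
          mul_le_mul_of_nonneg_left ih (by positivity)
      _ = Real.exp 1 * ((n : ℝ) + 1) ^ (n + 2) := by ring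
      _ ≤ _ := h1

/-- With `y` the floor, `hu` gives `y + 1 ≤ u`, so the Stirling estimate yields `y! e^y ≤ u^(y+1)`.
A single term of the exponential series just below its peak thus nearly reaches `e^((1-δ)u)`. -/
lemma exp_div_le_pow_div_factorial {u δ : ℝ} (hδ : 0 < δ) (hδ1 : δ < 1) (hu : 1 ≤ δ * u) :
    Real.exp ((1 - δ) * u - 1) / u ≤ u ^ ⌊(1 - δ) * u⌋₊ / (⌊(1 - δ) * u⌋₊.factorial : ℝ) := by
  have hu0 : 0 < u := by
    by_contra h
    nlinarith
  set y := ⌊(1 - δ) * u⌋₊ with hy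
  have h1 : (y : ℝ) ≤ (1 - δ) * u := Nat.floor_le (mul_nonneg (by linarith) hu0.le)
  have h2 : (1 - δ) * u < y + 1 := Nat.lt_floor_add_one _
  have h3 : (y : ℝ) + 1 ≤ u := by nlinarith
  have h4 := factorial_mul_exp_le y
  have h5 : ((y : ℝ) + 1) ^ (y + 1) ≤ u ^ (y + 1) := pow_le_pow_left₀ (by positivity) h3 _
  have h6 : Real.exp ((1 - δ) * u - 1) ≤ Real.exp y := Real.exp_le_exp.2 (by linarith)
  rw [div_le_div_iff₀ hu0 (by positivity)]
  calc Real.exp ((1 - δ) * u - 1) * y.factorial ≤ Real.exp y * y.factorial :=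
        mul_le_mul_of_nonneg_right h6 (by positivity)
    _ = y.factorial * Real.exp y := mul_comm _ _
    _ ≤ u ^ (y + 1) := h4.trans h5
    _ = _ := pow_succ _ _

lemma eventually_exp_le_pow_div_factorial {t δ ε : ℝ} (ht : 0 ≤ t) (hδ : 0 < δ) (hδ1 : δ < 1)
    (hε : 0 < ε) : ∀ᶠ N : ℕ in atTop, Real.exp (N * ((1 - δ) * t - ε)) ≤
      (N * t) ^ ⌊(1 - δ) * (N * t)⌋₊ / (⌊(1 - δ) * (N * t)⌋₊.factorial : ℝ) := by
  rcases ht.eq_or_lt with rfl | ht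
  · refine Eventually.of_forall fun N => ?_
    simp only [mul_zero, Nat.floor_zero, pow_zero, Nat.factorial_zero, Nat.cast_one, div_one]
    rw [Real.exp_le_one_iff]
    have : (0 : ℝ) ≤ N := Nat.cast_nonneg N
    nlinarith
  · have h1 : ∀ᶠ N : ℕ in atTop, 1 ≤ δ * (N * t) := by
      filter_upwards [(tendsto_natCast_atTop_atTop (R := ℝ)).eventually_ge_atTop (1 / (δ * t))]
        with N hN
      rw [div_le_iff₀ (by positivity)] at hN
      linarith
    have h2 : ∀ᶠ N : ℕ in atTop, (N : ℝ) * (t * Real.exp 1) ≤ Real.exp (ε * N) := by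
      have h3 := (Real.tendsto_exp_div_pow_atTop 1)
      have h4 : Tendsto (fun N : ℕ => ε * (N : ℝ)) atTop atTop :=
        (tendsto_natCast_atTop_atTop (R := ℝ)).const_mul_atTop hε
      filter_upwards [(h3.comp h4).eventually_ge_atTop (t * Real.exp 1 / ε), eventually_gt_atTop 0]
        with N hN hN0
      have hN0 : (0 : ℝ) < N := by exact_mod_cast hN0
      simp only [Function.comp, pow_one] at hN
      rw [div_le_div_iff₀ hε (by positivity)] at hN
      have : ε * (N * (t * Real.exp 1)) ≤ ε * Real.exp (ε * N) := by nlinarith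
      exact le_of_mul_le_mul_left this hε
    filter_upwards [h1, h2, eventually_gt_atTop 0] with N hN1 hN2 hN0
    have hN0 : (0 : ℝ) < N := by exact_mod_cast hN0
    refine le_trans ?_ (exp_div_le_pow_div_factorial hδ hδ1 hN1)
    rw [le_div_iff₀ (by positivity)]
    have : Real.exp ((1 - δ) * (N * t) - 1) =
        Real.exp (N * ((1 - δ) * t - ε)) * (Real.exp (ε * N) * Real.exp (-1)) := by
      rw [← Real.exp_add, ← Real.exp_add]; congr 1; ring
    rw [this]
    refine mul_le_mul_of_nonneg_left ?_ (Real.exp_pos _).le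
    have h5 := mul_le_mul_of_nonneg_right hN2 (Real.exp_pos (-1)).le
    have h6 : Real.exp 1 * Real.exp (-1) = 1 := by rw [← Real.exp_add]; simp
    calc N * t = N * (t * Real.exp 1) * Real.exp (-1) := by
          rw [mul_assoc, mul_assoc, h6, mul_one]
      _ ≤ _ := h5

/-- Contribution of a single partition with prescribed multiplicities. -/
lemma prod_le_partSum {x : ℕ → ℝ} (hx : ∀ j, 0 ≤ x j) (J : ℕ) (c : ℕ → ℕ) :
    ∏ j ∈ Finset.Icc 1 J, x j ^ c j / ((c j).factorial : ℝ) ≤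
      partSum x (∑ j ∈ Finset.Icc 1 J, c j * j) := by
  classical
  have hc : ∀ i, (∑ j ∈ Finset.Icc 1 J, Multiset.replicate (c j) j).count i =
      if i ∈ Finset.Icc 1 J then c i else 0 := fun i => by
    simp [Multiset.count_sum', Multiset.count_replicate]
  have hmem : ∀ {i}, i ∈ ∑ j ∈ Finset.Icc 1 J, Multiset.replicate (c j) j →
      i ∈ Finset.Icc 1 J := fun {i} hi => by
    rw [← Multiset.count_pos, hc] at hi
    by_contra h
    rw [if_neg h] at hi
    exact lt_irrefl _ hi
  let p : (∑ j ∈ Finset.Icc 1 J, c j * j).Partition :=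
    ⟨∑ j ∈ Finset.Icc 1 J, Multiset.replicate (c j) j, fun {i} hi => (Finset.mem_Icc.1 (hmem hi)).1,
      by simp [Multiset.sum_sum]⟩
  refine le_trans (le_of_eq ?_) (partWeight_le_partSum hx p)
  rw [partWeight_eq_prod x (T := Finset.Icc 1 J) fun i hi => hmem (Multiset.mem_toFinset.1 hi)]
  refine Finset.prod_congr rfl fun j hj => ?_
  have : p.parts.count j = c j := (hc j).trans (if_pos hj)
  rw [this]

/-- One partition, with multiplicities near `N b_j / j` for `j ≤ J`, already carries the exponential
rate. Shrinking by `1 - δ` leaves room below `N` for the remaining parts. -/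
lemma eventually_exp_le_partSum {b : ℕ → ℝ} (hb : ∀ j, 0 ≤ b j) {δ ε : ℝ} (hδ : 0 < δ)
    (hδ1 : δ < 1) (hε : 0 < ε) (J : ℕ) :
    ∀ᶠ N : ℕ in atTop, ∀ x : ℕ → ℝ, Dominates b N x →
      Real.exp (N * ((1 - δ) * (∑ j ∈ Finset.Icc 1 J, b j / j) - ε)) ≤
        partSum x (∑ j ∈ Finset.Icc 1 J, ⌊(1 - δ) * (N * (b j / j))⌋₊ * j) := by
  have h1 : ∀ᶠ N : ℕ in atTop, ∀ j ∈ Finset.Icc 1 J,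
      Real.exp (N * ((1 - δ) * (b j / j) - ε / (J + 1))) ≤
      (N * (b j / j)) ^ ⌊(1 - δ) * (N * (b j / j))⌋₊ /
        (⌊(1 - δ) * (N * (b j / j))⌋₊.factorial : ℝ) :=
    (Finset.eventually_all _).2 fun j _ =>
      eventually_exp_le_pow_div_factorial (div_nonneg (hb j) (Nat.cast_nonneg j)) hδ hδ1
        (by positivity)
  filter_upwards [h1] with N hN x hx
  refine le_trans ?_ (prod_le_partSum hx.nonneg J _)
  have h2 : ∏ j ∈ Finset.Icc 1 J, Real.exp (N * ((1 - δ) * (b j / j) - ε / (J + 1))) ≤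
      ∏ j ∈ Finset.Icc 1 J, x j ^ ⌊(1 - δ) * (N * (b j / j))⌋₊ /
        (⌊(1 - δ) * (N * (b j / j))⌋₊.factorial : ℝ) := by
    refine Finset.prod_le_prod (fun j _ => (Real.exp_pos _).le) fun j hj => (hN j hj).trans ?_
    have := hx.le j
    have h0 : 0 ≤ N * (b j / j) := by have := hb j; positivity
    gcongr
  refine le_trans ?_ h2
  rw [← Real.exp_sum, Real.exp_le_exp, ← Finset.mul_sum, Finset.sum_sub_distrib, ← Finset.mul_sum]
  refine mul_le_mul_of_nonneg_left ?_ (Nat.cast_nonneg N)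
  have : ∑ j ∈ Finset.Icc 1 J, ε / ((J : ℝ) + 1) ≤ ε := by
    rw [Finset.sum_const, Nat.card_Icc, nsmul_eq_mul, Nat.add_sub_cancel, mul_div_assoc',
      div_le_iff₀ (by positivity)]
    nlinarith
  linarith

lemma sum_floor_mul_bounds {b : ℕ → ℝ} (hb : ∀ j, 0 ≤ b j) {δ : ℝ} (hδ1 : δ ≤ 1) (J N : ℕ) :
    ((∑ j ∈ Finset.Icc 1 J, ⌊(1 - δ) * (N * (b j / j))⌋₊ * j : ℕ) : ℝ) ≤
        (1 - δ) * N * ∑ j ∈ Finset.Icc 1 J, b j ∧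
      (1 - δ) * N * ∑ j ∈ Finset.Icc 1 J, b j - J ^ 2 ≤
        ((∑ j ∈ Finset.Icc 1 J, ⌊(1 - δ) * (N * (b j / j))⌋₊ * j : ℕ) : ℝ) := by
  have hterm : ∀ j ∈ Finset.Icc 1 J, (1 - δ) * (N * (b j / j)) * j = (1 - δ) * N * b j := by
    intro j hj
    have : (j : ℝ) ≠ 0 := by have := (Finset.mem_Icc.1 hj).1; norm_cast; omega
    field_simp
  constructor
  · rw [Finset.mul_sum, Nat.cast_sum]
    refine Finset.sum_le_sum fun j hj => ?_
    rw [← hterm j hj, Nat.cast_mul]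
    have h0 : 0 ≤ (1 - δ) * (N * (b j / j)) :=
      mul_nonneg (by linarith) (mul_nonneg (Nat.cast_nonneg N)
        (div_nonneg (hb j) (Nat.cast_nonneg j)))
    exact mul_le_mul_of_nonneg_right (Nat.floor_le h0) (Nat.cast_nonneg j)
  · have h1 : ∑ j ∈ Finset.Icc 1 J, (j : ℝ) ≤ J ^ 2 := by
      have : ∑ j ∈ Finset.Icc 1 J, (j : ℝ) ≤ ∑ j ∈ Finset.Icc 1 J, (J : ℝ) :=
        Finset.sum_le_sum fun j hj => by exact_mod_cast (Finset.mem_Icc.1 hj).2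
      simpa [sq] using this
    have h2 : ∑ j ∈ Finset.Icc 1 J, ((1 - δ) * N * b j - j) ≤
        ((∑ j ∈ Finset.Icc 1 J, ⌊(1 - δ) * (N * (b j / j))⌋₊ * j : ℕ) : ℝ) := by
      rw [Nat.cast_sum]
      refine Finset.sum_le_sum fun j hj => ?_
      rw [← hterm j hj, Nat.cast_mul]
      have h3 := (Nat.lt_floor_add_one ((1 - δ) * (N * (b j / j)))).le
      have h4 := mul_le_mul_of_nonneg_right h3 (Nat.cast_nonneg (α := ℝ) j)
      linarith
    rw [Finset.sum_sub_distrib, ← Finset.mul_sum] at h2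
    linarith

/-- The sums over partitions of `N - k` are at least `exp (N (∑ b_j / j - o(1)))`: typical
multiplicities produce parts of total size about `(∑ b_j) N`, and the remainder is filled with
parts of one size `j` for which `b_j ^ (1 / j)` is close to `1`. -/
lemma eventually_exp_le_partSum_sub {b : ℕ → ℝ} (hb : ∀ j, 0 ≤ b j) (hb0 : b 0 = 0) {m g : ℝ}
    (hm : HasSum b m) (hg : HasSum (fun j => b j / j) g) (hm1 : m ≤ 1)
    (hgcd : ∀ d : ℕ, (∀ j, 1 ≤ j → 0 < b j → d ∣ j) → d = 1)
    (hfill : ∀ ε : ℝ, 0 < ε → ∃ j, 1 ≤ j ∧ 0 < b j ∧ (1 - m) * -Real.log (b j) ≤ ε * j)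
    (k : ℕ) {ε : ℝ} (hε : 0 < ε) :
    ∀ᶠ N : ℕ in atTop, ∀ x : ℕ → ℝ, Dominates b N x →
      Real.exp (N * (g - ε)) ≤ partSum x (N - k) := by
  -- The parts of size `i` are the filler; `l` below is their cost in the exponent per unit of size.
  obtain ⟨i, hi1, hbi, hi⟩ := hfill (ε / 6) (by positivity)
  have hi0 : (0 : ℝ) < i := by exact_mod_cast hi1
  have hbi1 : b i ≤ 1 := (le_hasSum hm i fun j _ => hb j).trans hm1
  set l := -Real.log (b i) / i with hl
  have hl0 : 0 ≤ l := div_nonneg (neg_nonneg.2 (Real.log_nonpos hbi.le hbi1)) hi0.le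
  have hml : (1 - m) * l ≤ ε / 6 := by
    rw [hl, mul_div_assoc', div_le_iff₀ hi0]; exact hi
  have hexp : ∀ q : ℕ, b i ^ q = Real.exp (-(l * (q * i : ℕ))) := fun q => by
    have : -(l * (q * i : ℕ)) = q * Real.log (b i) := by
      rw [hl]; push_cast; field_simp
    rw [this, Real.exp_nat_mul, Real.exp_log hbi]
  have hIcc : ∀ f : ℕ → ℝ, f 0 = 0 → ∀ J, ∑ j ∈ Finset.range (J + 1), f j =
      ∑ j ∈ Finset.Icc 1 J, f j := fun f hf J => by
    rw [Finset.range_eq_Ico, Finset.sum_eq_sum_Ico_succ_bot (Nat.succ_pos J), hf, zero_add]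
    rfl
  have hg0 : 0 ≤ g := hg.nonneg fun j => div_nonneg (hb j) (Nat.cast_nonneg j)
  obtain ⟨J, hJg, hJm⟩ : ∃ J, g - ε / 12 ≤ ∑ j ∈ Finset.Icc 1 J, b j / j ∧
      l * (m - ∑ j ∈ Finset.Icc 1 J, b j) ≤ ε / 12 := by
    have h1 : ∀ᶠ J in atTop, g - ε / 12 ≤ ∑ j ∈ Finset.range (J + 1), b j / j :=
      Tendsto.eventually_const_le (show g - ε / 12 < g by linarith)
        (hg.tendsto_sum_nat.comp (tendsto_add_atTop_nat 1))
    have h2 : Tendsto (fun J => l * (m - ∑ j ∈ Finset.range (J + 1), b j)) atTop (𝓝 0) := by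
      have := ((hm.tendsto_sum_nat.comp (tendsto_add_atTop_nat 1)).const_sub m).const_mul l
      simpa using this
    obtain ⟨J, h3, h4⟩ :=
      (h1.and (h2.eventually_le_const (show (0 : ℝ) < ε / 12 by positivity))).exists
    refine ⟨J, ?_, ?_⟩
    · rw [← hIcc _ (by simp)]; exact h3
    · rw [← hIcc _ hb0]; exact h4
  set gJ := ∑ j ∈ Finset.Icc 1 J, b j / j with hgJ
  set mJ := ∑ j ∈ Finset.Icc 1 J, b j with hmJ
  have hmJm : mJ ≤ m := sum_le_hasSum _ (fun j _ => hb j) hm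
  have hmJ0 : 0 ≤ mJ := Finset.sum_nonneg fun j _ => hb j
  have hgJg : gJ ≤ g := sum_le_hasSum _ (fun j _ => div_nonneg (hb j) (Nat.cast_nonneg j)) hg
  obtain ⟨δ, hδ, hδ1, hδg, hδl⟩ : ∃ δ : ℝ, 0 < δ ∧ δ < 1 ∧ δ * g ≤ ε / 12 ∧ δ * l ≤ ε / 12 := by
    refine ⟨min (1 / 2) (ε / (12 * (g + l + 1))), by positivity,
      (min_le_left _ _).trans_lt (by norm_num), ?_, ?_⟩
    all_goals
      have h1 := min_le_right (1 / 2) (ε / (12 * (g + l + 1)))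
      have h2 : ε / (12 * (g + l + 1)) * (g + l + 1) = ε / 12 := by field_simp
      have h3 : 0 < ε / (12 * (g + l + 1)) := by positivity
      have h4 : 0 < min (1 / 2) (ε / (12 * (g + l + 1))) := by positivity
      nlinarith
  obtain ⟨m0, hm0⟩ := Nat.exists_mem_closure_of_ge {j : ℕ | 1 ≤ j ∧ 0 < b j}
  have hset : Nat.setGcd {j : ℕ | 1 ≤ j ∧ 0 < b j} = 1 :=
    hgcd _ fun j h1 h2 => Nat.setGcd_dvd_of_mem ⟨h1, h2⟩
  have hcl : ∀ s, m0 ≤ s → s ∈ AddSubmonoid.closure {j : ℕ | 1 ≤ j ∧ 0 < b j} := fun s hs =>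
    hm0 s hs (by rw [hset]; exact one_dvd s)
  choose! c hc0 hc using fun s (hs : m0 ≤ s) => exists_const_partSum_add (hcl s hs)
  -- Only the sizes `m0 + s` with `s < i` will be inserted, to correct the residue modulo `i`; the
  -- smallest of their constants serves for all `N`.
  obtain ⟨s0, -, hs0⟩ := Finset.exists_min_image (Finset.range i) (fun s => c (m0 + s))
    ⟨0, Finset.mem_range.2 hi1⟩
  set C := c (m0 + s0) with hC
  have hC0 : 0 < C := hc0 _ (Nat.le_add_right _ _)
  have hlarge : ∀ᶠ N : ℕ in atTop, (m0 + k : ℝ) ≤ δ * N ∧ l * J ^ 2 - Real.log C ≤ ε / 3 * N := by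
    have h1 := (tendsto_natCast_atTop_atTop (R := ℝ)).const_mul_atTop hδ
    have h2 := (tendsto_natCast_atTop_atTop (R := ℝ)).const_mul_atTop
      (show (0 : ℝ) < ε / 3 by positivity)
    exact (h1.eventually_ge_atTop _).and (h2.eventually_ge_atTop _)
  filter_upwards [eventually_exp_le_partSum hb hδ hδ1 (show 0 < ε / 6 by positivity) J, hlarge]
    with N hN hNl x hx
  have hNx := hN x hx
  rw [← hgJ] at hNx
  set L := ∑ j ∈ Finset.Icc 1 J, ⌊(1 - δ) * (N * (b j / j))⌋₊ * j with hL
  have hN0 : (0 : ℝ) ≤ N := Nat.cast_nonneg N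
  obtain ⟨hLle, hLge⟩ := sum_floor_mul_bounds hb hδ1.le J N
  rw [← hL, ← hmJ] at hLle hLge
  have hLN : L + m0 + k ≤ N := by
    have : (L : ℝ) + m0 + k ≤ N := by
      have h1 : (1 - δ) * N * mJ ≤ (1 - δ) * N * 1 :=
        mul_le_mul_of_nonneg_left (hmJm.trans hm1) (mul_nonneg (by linarith) hN0)
      linarith [hNl.1]
    exact_mod_cast this
  -- The target is split as `L` from the typical parts, `m0 + D % i` from the semigroup at the
  -- bounded cost `C`, and `D / i` filler parts.
  set D := N - k - L - m0 with hD
  have hdecomp : N - k = L + (m0 + D % i) + D / i * i := by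
    have := Nat.mod_add_div' D i
    omega
  have h1 : C * partSum x L ≤ partSum x (L + (m0 + D % i)) := by
    refine le_trans (mul_le_mul_of_nonneg_right (hs0 (D % i) (Finset.mem_range.2
      (Nat.mod_lt _ hi1))) (partSum_nonneg hx.nonneg _)) ?_
    exact hc _ (Nat.le_add_right _ _) N x hx L (by omega)
  have h2 := hx.partSum_add_mul hi1 hbi.le (D / i) (M := L + (m0 + D % i)) (by omega)
  rw [← hdecomp, hexp] at h2
  have hDle : ((D / i * i : ℕ) : ℝ) ≤ N - ((1 - δ) * N * mJ - J ^ 2) := by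
    have : ((D / i * i : ℕ) : ℝ) + L ≤ N := by
      have : D / i * i + L ≤ N := by omega
      exact_mod_cast this
    linarith
  calc Real.exp (N * (g - ε))
      ≤ Real.exp (-(l * (D / i * i : ℕ))) * (C * Real.exp (N * ((1 - δ) * gJ - ε / 6))) := by
        have e0 : ∀ a, C * Real.exp a = Real.exp (Real.log C + a) := fun a => by
          rw [Real.exp_add, Real.exp_log hC0]
        rw [e0, ← Real.exp_add, Real.exp_le_exp]
        -- The budget per unit of `N`: `ε/6` from the single-partition bound, `ε/6` from truncating
        -- and shrinking `g`, `ε/3` for the filler, and `ε/3` for `C` and the rounding.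
        have e1 := mul_le_mul_of_nonneg_left hDle hl0
        have e2 : g - ε / 6 ≤ (1 - δ) * gJ := by nlinarith
        have e3 : l * (1 - (1 - δ) * mJ) ≤ ε / 3 := by nlinarith
        have e4 := mul_le_mul_of_nonneg_left e2 hN0
        have e5 := mul_le_mul_of_nonneg_left e3 hN0
        linarith [hNl.2]
    _ ≤ Real.exp (-(l * (D / i * i : ℕ))) * (C * partSum x L) := by gcongr
    _ ≤ Real.exp (-(l * (D / i * i : ℕ))) * partSum x (L + (m0 + D % i)) := by gcongr
    _ ≤ partSum x (N - k) := h2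

/-! ### Ratio asymptotics of partition sums -/

/-- Jensen's inequality for the exponential and a finite sum with nonnegative weights. -/
lemma exp_mean_le {ι : Type*} (s : Finset ι) (w c : ι → ℝ) (hw : ∀ i ∈ s, 0 ≤ w i)
    (hpos : 0 < ∑ i ∈ s, w i) (t : ℝ) :
    Real.exp (t * ((∑ i ∈ s, w i * c i) / ∑ i ∈ s, w i)) * ∑ i ∈ s, w i ≤
      ∑ i ∈ s, w i * Real.exp (t * c i) := by
  set W := ∑ i ∈ s, w i with hW
  set μ := (∑ i ∈ s, w i * c i) / W with hμ
  have h1 : ∑ i ∈ s, w i * (Real.exp (t * μ) * (1 + t * (c i - μ))) ≤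
      ∑ i ∈ s, w i * Real.exp (t * c i) := by
    refine Finset.sum_le_sum fun i hi => mul_le_mul_of_nonneg_left ?_ (hw i hi)
    have h2 := Real.add_one_le_exp (t * (c i - μ))
    calc Real.exp (t * μ) * (1 + t * (c i - μ)) ≤ Real.exp (t * μ) * Real.exp (t * (c i - μ)) := by
          gcongr; linarith
      _ = _ := by rw [← Real.exp_add]; congr 1; ring
  refine le_trans (le_of_eq ?_) h1
  have h3 : ∑ i ∈ s, w i * c i = μ * W := by rw [hμ]; field_simp
  have : ∀ i, w i * (Real.exp (t * μ) * (1 + t * (c i - μ))) =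
      Real.exp (t * μ) * (1 - t * μ) * w i + Real.exp (t * μ) * t * (w i * c i) := fun i => by ring
  simp_rw [this]
  rw [Finset.sum_add_distrib, ← Finset.mul_sum, ← Finset.mul_sum, h3, ← hW]
  ring

/-- Exponential upper bounds identify the limit of a sequence of means. -/
lemma tendsto_of_eventually_mul_le {y : ℕ → ℝ} {q : ℝ} (hq : 0 ≤ q)
    (h : ∀ t η : ℝ, 0 < η → ∀ᶠ N in atTop, t * y N ≤ (Real.exp t - 1) * q + η) :
    Tendsto y atTop (𝓝 q) := by
  rw [Metric.tendsto_atTop']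
  intro ε hε
  -- Since `e^(±t) - 1 ≤ ±t + t^2`, taking `η = t^2` and dividing by `t` leaves an error of at most
  -- `t (q + 1)` on both sides.
  obtain ⟨t, ht, ht1, htq⟩ : ∃ t : ℝ, 0 < t ∧ t ≤ 1 ∧ t * (q + 1) < ε := by
    refine ⟨min 1 (ε / (2 * (q + 1))), by positivity, min_le_left _ _, ?_⟩
    have h1 := min_le_right 1 (ε / (2 * (q + 1)))
    have h2 : ε / (2 * (q + 1)) * (q + 1) = ε / 2 := by field_simp
    nlinarith
  have ht2 : 0 < t ^ 2 := by positivity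
  have := (h t (t ^ 2) ht2).and (h (-t) (t ^ 2) ht2)
  obtain ⟨n, hn⟩ := eventually_atTop.1 this
  refine ⟨n, fun N hN => ?_⟩
  obtain ⟨h1, h2⟩ := hn N hN.le
  have e1 := (abs_le.1 (Real.abs_exp_sub_one_sub_id_le (x := t)
    (by rw [abs_of_pos ht]; exact ht1))).2
  have e2 := (abs_le.1 (Real.abs_exp_sub_one_sub_id_le (x := -t)
    (by rw [abs_neg, abs_of_pos ht]; exact ht1))).2
  have f1 : t * y N ≤ t * (q + t * (q + 1)) := by nlinarith
  have f2 : t * (q - t * (q + 1)) ≤ t * y N := by nlinarith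
  have g1 := le_of_mul_le_mul_left f1 ht
  have g2 := le_of_mul_le_mul_left f2 ht
  rw [Real.dist_eq, abs_lt]
  constructor <;> linarith

/-- The conditions on the point `r` under which the partition sums are analysed. -/
structure SaddlePoint (θ κ : ℕ → ℝ) (r : ℝ) : Prop where
  θ_nonneg : ∀ j, 1 ≤ j → 0 ≤ θ j
  κ_nonneg : ∀ j, 1 ≤ j → 0 ≤ κ j
  pos : 0 < r
  -- Here `1 - m` is the fraction of `N` left over by the typical parts, and the last clause says
  -- that filling it is cheap on the exponential scale. The form `j * (κ j / j)` makes the term `j =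
  -- 0` vanish.
  mass : ∃ m : ℝ, m ≤ 1 ∧ HasSum (fun j : ℕ => (j : ℝ) * (κ j / j) * r ^ j) m ∧
    ∀ ε : ℝ, 0 < ε → ∃ j : ℕ, 1 ≤ j ∧ 0 < κ j ∧ (1 - m) * -Real.log (κ j * r ^ j) ≤ ε * j
  gcd_eq_one : ∀ d : ℕ, (∀ j, 1 ≤ j → 0 < κ j → d ∣ j) → d = 1
  summable_θ : ∀ ρ : ℝ, 0 < ρ → ρ < r → Summable fun j : ℕ => θ j / j * ρ ^ j

lemma cycleParam_nonneg {θ κ : ℕ → ℝ} (hθ : ∀ j, 1 ≤ j → 0 ≤ θ j) (hκ : ∀ j, 1 ≤ j → 0 ≤ κ j)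
    (N j : ℕ) : 0 ≤ cycleParam θ κ N j := by
  rcases Nat.eq_zero_or_pos j with rfl | hj
  · simp [cycleParam]
  · have := hθ j hj
    have := hκ j hj
    unfold cycleParam
    positivity

lemma div_nonneg_of_forall_pos {a : ℕ → ℝ} (ha : ∀ j, 1 ≤ j → 0 ≤ a j) (j : ℕ) :
    0 ≤ a j / (j : ℝ) := by
  rcases Nat.eq_zero_or_pos j with rfl | hj
  · simp
  · exact div_nonneg (ha j hj) (Nat.cast_nonneg j)

namespace SaddlePoint

variable {θ κ : ℕ → ℝ} {r : ℝ}

lemma param_nonneg (h : SaddlePoint θ κ r) (N j : ℕ) : 0 ≤ cycleParam θ κ N j :=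
  cycleParam_nonneg h.θ_nonneg h.κ_nonneg N j

lemma summable (h : SaddlePoint θ κ r) : Summable fun j : ℕ => κ j / j * r ^ j := by
  obtain ⟨m, -, hm, -⟩ := h.mass
  refine Summable.of_nonneg_of_le (fun j => mul_nonneg (div_nonneg_of_forall_pos h.κ_nonneg j)
    (pow_nonneg h.pos.le j)) (fun j => ?_) hm.summable
  rcases Nat.eq_zero_or_pos j with rfl | hj
  · simp
  · have h0 := mul_nonneg (div_nonneg_of_forall_pos h.κ_nonneg j) (pow_nonneg h.pos.le j)
    have h1 : (1 : ℝ) ≤ j := by exact_mod_cast hj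
    rw [mul_assoc]
    exact le_mul_of_one_le_left h0 h1

/-- Multiplying the parameters by `r^j` multiplies `Z_M` by `r^M`; the tilted parameters dominate `N
b_j / j` with `b_j = κ_j r^j`, since the `θ` contribution is nonnegative. -/
lemma eventually_le_partSum (h : SaddlePoint θ κ r) (k : ℕ) {ε : ℝ} (hε : 0 < ε) :
    ∀ᶠ N : ℕ in atTop, Real.exp (N * ((∑' j : ℕ, κ j / j * r ^ j) - ε)) ≤
      partSum (cycleParam θ κ N) (N - k) * r ^ (N - k) := by
  obtain ⟨m, hm1, hm, hfill⟩ := h.mass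
  have hbj : ∀ j : ℕ, 1 ≤ j → (j : ℝ) * (κ j / j) * r ^ j = κ j * r ^ j := fun j hj => by
    have : (j : ℝ) ≠ 0 := by norm_cast; omega
    field_simp
  have hdiv : ∀ j : ℕ, (j : ℝ) * (κ j / j) * r ^ j / j = κ j / j * r ^ j := fun j => by
    rcases Nat.eq_zero_or_pos j with rfl | hj
    · simp
    · have : (j : ℝ) ≠ 0 := by norm_cast; omega
      field_simp
  have hpos : ∀ j : ℕ, 1 ≤ j → 0 < κ j → 0 < (j : ℝ) * (κ j / j) * r ^ j := fun j hj hk => by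
    rw [hbj j hj]; exact mul_pos hk (pow_pos h.pos j)
  have key := eventually_exp_le_partSum_sub (b := fun j : ℕ => (j : ℝ) * (κ j / j) * r ^ j)
    (fun j => mul_nonneg (mul_nonneg (Nat.cast_nonneg j) (div_nonneg_of_forall_pos h.κ_nonneg j))
      (pow_nonneg h.pos.le j)) (by simp) hm (by simp_rw [hdiv]; exact h.summable.hasSum) hm1
    (fun d hd => h.gcd_eq_one d fun j hj hk => hd j hj (hpos j hj hk))
    (fun ε hε => by
      obtain ⟨j, hj, hk, hle⟩ := hfill ε hε
      exact ⟨j, hj, hpos j hj hk, by rw [hbj j hj]; exact hle⟩) k hε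
  filter_upwards [key] with N hN
  rw [← partSum_mul_pow]
  refine hN _ ⟨fun j => mul_nonneg (h.param_nonneg N j) (pow_nonneg h.pos.le j), fun j => ?_⟩
  rw [hdiv]
  have h1 : N * (κ j / j * r ^ j) + θ j / j * r ^ j = cycleParam θ κ N j * r ^ j := by
    rw [cycleParam]; ring
  have h2 := mul_nonneg (div_nonneg_of_forall_pos h.θ_nonneg j) (pow_nonneg h.pos.le j)
  linarith

lemma eventually_partSum_pos (h : SaddlePoint θ κ r) (k : ℕ) :
    ∀ᶠ N : ℕ in atTop, 0 < partSum (cycleParam θ κ N) (N - k) := by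
  filter_upwards [h.eventually_le_partSum k one_pos] with N hN
  exact pos_of_mul_pos_left ((Real.exp_pos _).trans_le hN) (pow_nonneg h.pos.le _)

/-- Chernoff bound for the partition sums with one tilted parameter. -/
lemma partSum_update_le (h : SaddlePoint θ κ r) {ρ a : ℝ} (hρ : 0 < ρ) (hρr : ρ < r) (ha : 0 ≤ a)
    {i : ℕ} (hi : 1 ≤ i) {N M : ℕ} (hM : i ≤ M) :
    partSum (Function.update (cycleParam θ κ N) i (cycleParam θ κ N i * a)) M * ρ ^ M ≤
      Real.exp ((∑' j : ℕ, θ j / j * ρ ^ j) + N * (∑' j : ℕ, κ j / j * r ^ j) +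
        (a - 1) * (cycleParam θ κ N i * ρ ^ i)) := by
  have hup : ∀ j, 0 ≤ Function.update (cycleParam θ κ N) i (cycleParam θ κ N i * a) j := fun j => by
    by_cases hj : j = i
    · subst hj
      rw [Function.update_self]
      exact mul_nonneg (h.param_nonneg N j) ha
    · rw [Function.update_of_ne hj]
      exact h.param_nonneg N j
  rw [← partSum_mul_pow]
  refine (partSum_le_exp (fun j => mul_nonneg (hup j) (pow_nonneg hρ.le j)) M).trans ?_
  rw [Real.exp_le_exp]
  have h1 : ∀ j ∈ Finset.Icc 1 M,
      Function.update (cycleParam θ κ N) i (cycleParam θ κ N i * a) j * ρ ^ j =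
      cycleParam θ κ N j * ρ ^ j + if j = i then (a - 1) * (cycleParam θ κ N i * ρ ^ i) else 0 := by
    intro j _
    split_ifs with hj
    · subst hj
      rw [Function.update_self]
      ring
    · rw [Function.update_of_ne hj, add_zero]
  rw [Finset.sum_congr rfl h1, Finset.sum_add_distrib, Finset.sum_ite_eq',
    if_pos (Finset.mem_Icc.2 ⟨hi, hM⟩)]
  refine add_le_add_left ?_ _
  -- The `κ` part is enlarged from `ρ` to `r`, where it still converges. The `θ` part stays at `ρ`,
  -- since its series may diverge at `r`; it contributes only a constant independent of `N`.
  have h2 : ∀ j ∈ Finset.Icc 1 M, cycleParam θ κ N j * ρ ^ j ≤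
      θ j / j * ρ ^ j + N * (κ j / j * r ^ j) := by
    intro j _
    have h3 : cycleParam θ κ N j * ρ ^ j = θ j / j * ρ ^ j + N * (κ j / j * ρ ^ j) := by
      rw [cycleParam]; ring
    have h4 := div_nonneg_of_forall_pos h.κ_nonneg j
    rw [h3]
    gcongr
  refine (Finset.sum_le_sum h2).trans ?_
  rw [Finset.sum_add_distrib, ← Finset.mul_sum]
  refine add_le_add ((h.summable_θ ρ hρ hρr).sum_le_tsum _ fun j _ =>
    mul_nonneg (div_nonneg_of_forall_pos h.θ_nonneg j) (pow_nonneg hρ.le j)) ?_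
  exact mul_le_mul_of_nonneg_left (h.summable.sum_le_tsum _ fun j _ =>
    mul_nonneg (div_nonneg_of_forall_pos h.κ_nonneg j) (pow_nonneg h.pos.le j)) (Nat.cast_nonneg N)

lemma tendsto_cycleParam_div (θ κ : ℕ → ℝ) (i : ℕ) :
    Tendsto (fun N : ℕ => cycleParam θ κ N i / N) atTop (𝓝 (κ i / i)) := by
  have h1 : Tendsto (fun N : ℕ => θ i / i * (1 / (N : ℝ)) + κ i / i) atTop
      (𝓝 (θ i / i * 0 + κ i / i)) :=
    (tendsto_one_div_atTop_nhds_zero_nat.const_mul _).add_const _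
  rw [mul_zero, zero_add] at h1
  refine h1.congr' ?_
  filter_upwards [eventually_gt_atTop 0] with N hN
  have : (N : ℝ) ≠ 0 := by norm_cast; omega
  rw [cycleParam]
  field_simp

/-- An exponential-moment bound for the mean number of parts of size `i`. -/
lemma mul_mean_le (h : SaddlePoint θ κ r) {ρ : ℝ} (hρ : 0 < ρ) (hρr : ρ < r) {i : ℕ} (hi : 1 ≤ i)
    {N k : ℕ} (hik : i + k ≤ N) {ε t : ℝ}
    (hN : Real.exp (N * ((∑' j : ℕ, κ j / j * r ^ j) - ε)) ≤
      partSum (cycleParam θ κ N) (N - k) * r ^ (N - k)) :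
    t * (cycleParam θ κ N i * (partSum (cycleParam θ κ N) (N - k - i) /
        partSum (cycleParam θ κ N) (N - k))) ≤
      N * (Real.log r - Real.log ρ) + (∑' j : ℕ, θ j / j * ρ ^ j) + N * ε +
        (Real.exp t - 1) * (cycleParam θ κ N i * ρ ^ i) := by
  set g := ∑' j : ℕ, κ j / j * r ^ j
  set G := ∑' j : ℕ, θ j / j * ρ ^ j
  set x := cycleParam θ κ N with hx
  set M := N - k with hM
  have hr := h.pos
  have hZ : 0 < partSum x M :=
    pos_of_mul_pos_left ((Real.exp_pos _).trans_le hN) (pow_nonneg hr.le _)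
  have hmom := sum_partWeight_mul_descFactorial x {i} (by simpa using hi) (fun _ => 1)
    (M := M - i) (L := M) (by rw [Finset.sum_singleton]; omega)
  simp only [Finset.prod_singleton, Nat.descFactorial_one, pow_one] at hmom
  -- Jensen bounds `exp (t E[C_i])` by the exponential moment of `C_i`, which is a quotient of
  -- partition sums with one parameter tilted by `e^t`.
  have hJ := exp_mean_le Finset.univ (fun p : M.Partition => partWeight x p.parts)
    (fun p => (p.parts.count i : ℝ)) (fun p _ => partWeight_nonneg (h.param_nonneg N) _) hZ t
  rw [hmom] at hJ
  have htilt := sum_partWeight_mul_pow_count x (Real.exp t) i M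
  simp_rw [← Real.exp_nat_mul, mul_comm _ t] at htilt
  rw [htilt] at hJ
  have hup := h.partSum_update_le hρ hρr (Real.exp_pos t).le hi (N := N) (M := M) (by omega)
  rw [← hx] at hup
  set s := t * (x i * (partSum x (M - i) / partSum x M)) with hs
  have hJ' : Real.exp s * partSum x M ≤
      partSum (Function.update x i (x i * Real.exp t)) M := by
    rw [hs, ← mul_div_assoc (x i)]; exact hJ
  have hρM : ρ ^ M = Real.exp (M * Real.log ρ) := by rw [Real.exp_nat_mul, Real.exp_log hρ]
  have hrM : r ^ M = Real.exp (M * Real.log r) := by rw [Real.exp_nat_mul, Real.exp_log hr]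
  have hZl : Real.exp (N * (g - ε) - M * Real.log r) ≤ partSum x M := by
    rw [Real.exp_sub, div_le_iff₀ (Real.exp_pos _), ← hrM]; exact hN
  have hfin : Real.exp (s + (N * (g - ε) - M * Real.log r) + M * Real.log ρ) ≤
      Real.exp (G + N * g + (Real.exp t - 1) * (x i * ρ ^ i)) := by
    rw [Real.exp_add, Real.exp_add, ← hρM]
    refine le_trans ?_ hup
    gcongr
    exact (mul_le_mul_of_nonneg_left hZl (Real.exp_pos _).le).trans hJ'
  rw [Real.exp_le_exp] at hfin
  -- Evaluating the upper bound at `ρ` and the lower one at `r` costs `M (log r - log ρ)`, here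
  -- enlarged from `M` to `N`.
  have hlog : 0 ≤ Real.log r - Real.log ρ := sub_nonneg.2 (Real.log_le_log hρ hρr.le)
  have hMN : (M : ℝ) ≤ N := by exact_mod_cast Nat.sub_le N k
  have := mul_le_mul_of_nonneg_right hMN hlog
  linarith

/-- The quantity is the mean of `C_i / N` over partitions of `N - k`. After division by `N`, the
cost of using `ρ` instead of `r` is `log r - log ρ`, so `ρ` is fixed close to `r` before `N` grows;
the `θ` series at `ρ` then disappears in the limit. -/
lemma tendsto_mean (h : SaddlePoint θ κ r) {i : ℕ} (hi : 1 ≤ i) (k : ℕ) :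
    Tendsto (fun N : ℕ => cycleParam θ κ N i / N * (partSum (cycleParam θ κ N) (N - k - i) /
        partSum (cycleParam θ κ N) (N - k))) atTop (𝓝 (κ i / i * r ^ i)) := by
  have hq : 0 ≤ κ i / i * r ^ i :=
    mul_nonneg (div_nonneg_of_forall_pos h.κ_nonneg i) (pow_nonneg h.pos.le i)
  refine tendsto_of_eventually_mul_le hq fun t η hη => ?_
  have hlim : Tendsto (fun ρ : ℝ => (Real.log r - Real.log ρ) + η / 2 +
      (Real.exp t - 1) * (κ i / i * ρ ^ i)) (𝓝[<] r)
      (𝓝 ((Real.log r - Real.log r) + η / 2 + (Real.exp t - 1) * (κ i / i * r ^ i))) := by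
    refine Tendsto.mono_left ?_ nhdsWithin_le_nhds
    refine ((tendsto_const_nhds.sub (Real.continuousAt_log h.pos.ne').tendsto).add_const _).add ?_
    exact (((continuous_id.pow i).tendsto r).const_mul _).const_mul _
  have hev := hlim.eventually_lt_const (show (Real.log r - Real.log r) + η / 2 +
    (Real.exp t - 1) * (κ i / i * r ^ i) < (Real.exp t - 1) * (κ i / i * r ^ i) + η by linarith)
  have hmem : Set.Ioo 0 r ∈ 𝓝[<] r := Ioo_mem_nhdsLT h.pos
  obtain ⟨ρ, hρlt, hρ, hρr⟩ := (hev.and hmem).exists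
  have hlim2 : Tendsto (fun N : ℕ => (Real.log r - Real.log ρ) +
      (∑' j : ℕ, θ j / j * ρ ^ j) * (1 / (N : ℝ)) + η / 2 +
      (Real.exp t - 1) * (cycleParam θ κ N i / N * ρ ^ i)) atTop
      (𝓝 ((Real.log r - Real.log ρ) + (∑' j : ℕ, θ j / j * ρ ^ j) * 0 + η / 2 +
      (Real.exp t - 1) * (κ i / i * ρ ^ i))) :=
    (((tendsto_one_div_atTop_nhds_zero_nat.const_mul _).const_add _).add_const _).add
      (((tendsto_cycleParam_div θ κ i).mul_const _).const_mul _)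
  rw [mul_zero, add_zero] at hlim2
  filter_upwards [hlim2.eventually_lt_const hρlt, eventually_ge_atTop (i + k),
    eventually_gt_atTop 0,
    h.eventually_le_partSum k (show 0 < η / 2 by positivity)] with N hN1 hN2 hN3 hN4
  refine le_trans ?_ hN1.le
  have hN0 : (0 : ℝ) < N := by exact_mod_cast hN3
  have := h.mul_mean_le hρ hρr hi hN2 (t := t) hN4
  refine le_of_mul_le_mul_left ?_ hN0
  calc N * (t * (cycleParam θ κ N i / N * (partSum (cycleParam θ κ N) (N - k - i) /
        partSum (cycleParam θ κ N) (N - k))))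
      = t * (cycleParam θ κ N i * (partSum (cycleParam θ κ N) (N - k - i) /
        partSum (cycleParam θ κ N) (N - k))) := by field_simp
    _ ≤ _ := this
    _ = _ := by field_simp

/-- The ratio of partition sums of sizes `N - k - i` and `N - k` tends to `r^i`. -/
theorem tendsto_partSum_ratio (h : SaddlePoint θ κ r) (i : ℕ) : ∀ k : ℕ,
    Tendsto (fun N : ℕ => partSum (cycleParam θ κ N) (N - k - i) /
      partSum (cycleParam θ κ N) (N - k)) atTop (𝓝 (r ^ i)) := by
  have hcl : ∀ s ∈ AddSubmonoid.closure {j : ℕ | 1 ≤ j ∧ 0 < κ j}, ∀ k : ℕ,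
      Tendsto (fun N : ℕ => partSum (cycleParam θ κ N) (N - k - s) /
        partSum (cycleParam θ κ N) (N - k)) atTop (𝓝 (r ^ s)) := by
    intro s hs
    induction hs using AddSubmonoid.closure_induction with
    | mem j hj =>
      intro k
      have hj0 : (0 : ℝ) < j := by exact_mod_cast hj.1
      -- The limiting mean is divided by `x_j / N → κ_j / j`, which requires `κ_j > 0`.
      have hp : 0 < κ j / j := div_pos hj.2 hj0
      have h1 := (h.tendsto_mean hj.1 k).div (tendsto_cycleParam_div θ κ j) hp.ne'
      rw [mul_div_cancel_left₀ _ hp.ne'] at h1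
      refine h1.congr' ?_
      filter_upwards [(tendsto_cycleParam_div θ κ j).eventually_const_lt hp] with N hN
      simp only [Pi.div_apply]
      rw [mul_div_cancel_left₀ _ hN.ne']
    | zero =>
      intro k
      rw [pow_zero]
      refine tendsto_const_nhds.congr' ?_
      filter_upwards [h.eventually_partSum_pos k] with N hN
      rw [Nat.sub_zero, div_self hN.ne']
    | add s t _ _ hs ht =>
      intro k
      have h1 := (ht (k + s)).mul (hs k)
      rw [← pow_add, add_comm t s] at h1
      refine h1.congr' ?_
      filter_upwards [h.eventually_partSum_pos (k + s)] with N hN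
      rw [Nat.sub_sub N k s, Nat.sub_sub N k (s + t), Nat.sub_sub N (k + s) t, add_assoc,
        div_mul_div_cancel₀ hN.ne']
  obtain ⟨m0, hm0⟩ := Nat.exists_mem_closure_of_ge {j : ℕ | 1 ≤ j ∧ 0 < κ j}
  have hset : Nat.setGcd {j : ℕ | 1 ≤ j ∧ 0 < κ j} = 1 :=
    h.gcd_eq_one _ fun j h1 h2 => Nat.setGcd_dvd_of_mem ⟨h1, h2⟩
  rw [hset] at hm0
  intro k
  -- Both `i + m0` and `m0` lie in the semigroup, and the ratio for `i` is the quotient of their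
  -- ratios, the second one started from `k + i`.
  have h1 := hcl (i + m0) (hm0 _ (Nat.le_add_left _ _) (one_dvd _)) k
  have h2 := hcl m0 (hm0 _ le_rfl (one_dvd _)) (k + i)
  have h3 := h1.div h2 (pow_pos h.pos m0).ne'
  rw [pow_add, mul_div_cancel_right₀ _ (pow_pos h.pos m0).ne'] at h3
  refine h3.congr' ?_
  filter_upwards [h.eventually_partSum_pos k, h.eventually_partSum_pos (k + i),
    h.eventually_partSum_pos (k + i + m0)] with N hN1 hN2 hN3
  simp only [Pi.div_apply]
  rw [Nat.sub_sub N k i, Nat.sub_sub N k (i + m0), Nat.sub_sub N (k + i) m0, ← add_assoc]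
  field_simp

end SaddlePoint

/-! ### Expectations -/

section Expect

variable {θ κ : ℕ → ℝ} {N : ℕ}

lemma permProb_nonneg (hθ : ∀ j, 1 ≤ j → 0 ≤ θ j) (hκ : ∀ j, 1 ≤ j → 0 ≤ κ j)
    (σ : Equiv.Perm (Fin N)) : 0 ≤ permProb θ κ N σ := by
  have hw : ∀ τ : Equiv.Perm (Fin N), 0 ≤ cycleWeight θ κ N τ := fun τ =>
    Finset.prod_nonneg fun j hj => pow_nonneg (add_nonneg (hθ j (Finset.mem_Icc.1 hj).1)
      (mul_nonneg (Nat.cast_nonneg N) (hκ j (Finset.mem_Icc.1 hj).1))) _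
  exact div_nonneg (hw σ) (mul_nonneg (Nat.cast_nonneg _) (mul_nonneg (by positivity)
    (Finset.sum_nonneg fun τ _ => hw τ)))

lemma expect_const (h : 0 < partSum (cycleParam θ κ N) N) (c : ℝ) :
    expect θ κ N (fun _ => c) = c := by
  rw [expect_eq θ κ N fun _ => c, ← Finset.sum_mul, ← partSum, mul_div_assoc, mul_comm,
    div_mul_cancel₀ _ h.ne']

lemma expect_add (X Y : Equiv.Perm (Fin N) → ℝ) :
    expect θ κ N (fun σ => X σ + Y σ) = expect θ κ N X + expect θ κ N Y := by
  simp_rw [expect, mul_add, Finset.sum_add_distrib]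

lemma expect_const_mul (c : ℝ) (X : Equiv.Perm (Fin N) → ℝ) :
    expect θ κ N (fun σ => c * X σ) = c * expect θ κ N X := by
  simp_rw [expect, Finset.mul_sum]
  exact Finset.sum_congr rfl fun σ _ => by ring

lemma expect_sub (X Y : Equiv.Perm (Fin N) → ℝ) :
    expect θ κ N (fun σ => X σ - Y σ) = expect θ κ N X - expect θ κ N Y := by
  simp_rw [expect, mul_sub, Finset.sum_sub_distrib]

lemma expect_mono (hθ : ∀ j, 1 ≤ j → 0 ≤ θ j) (hκ : ∀ j, 1 ≤ j → 0 ≤ κ j)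
    {X Y : Equiv.Perm (Fin N) → ℝ} (h : ∀ σ, X σ ≤ Y σ) :
    expect θ κ N X ≤ expect θ κ N Y :=
  Finset.sum_le_sum fun σ _ => mul_le_mul_of_nonneg_left (h σ) (permProb_nonneg hθ hκ σ)

lemma expect_nonneg (hθ : ∀ j, 1 ≤ j → 0 ≤ θ j) (hκ : ∀ j, 1 ≤ j → 0 ≤ κ j)
    {X : Equiv.Perm (Fin N) → ℝ} (h : ∀ σ, 0 ≤ X σ) : 0 ≤ expect θ κ N X :=
  Finset.sum_nonneg fun σ _ => mul_nonneg (permProb_nonneg hθ hκ σ) (h σ)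

lemma abs_expect_sub_le (hθ : ∀ j, 1 ≤ j → 0 ≤ θ j) (hκ : ∀ j, 1 ≤ j → 0 ≤ κ j)
    {X Y Z : Equiv.Perm (Fin N) → ℝ} (h : ∀ σ, |X σ - Y σ| ≤ Z σ) :
    |expect θ κ N X - expect θ κ N Y| ≤ expect θ κ N Z := by
  rw [← expect_sub, expect]
  refine (Finset.abs_sum_le_sum_abs _ _).trans (Finset.sum_le_sum fun σ _ => ?_)
  rw [abs_mul, abs_of_nonneg (permProb_nonneg hθ hκ σ)]
  exact mul_le_mul_of_nonneg_left (h σ) (permProb_nonneg hθ hκ σ)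

end Expect

/-! ### Polynomials and the Poisson law -/

/-- The polynomial functions on `ℕ`, as the span of the falling factorials. -/
def fallingSpan : Submodule ℝ (ℕ → ℝ) :=
  Submodule.span ℝ (Set.range fun n : ℕ => fun x : ℕ => (x.descFactorial n : ℝ))

lemma descFactorial_mem_fallingSpan (n : ℕ) :
    (fun x : ℕ => (x.descFactorial n : ℝ)) ∈ fallingSpan :=
  Submodule.subset_span ⟨n, rfl⟩

lemma const_mem_fallingSpan (c : ℝ) : (fun _ : ℕ => c) ∈ fallingSpan := by
  have := fallingSpan.smul_mem c (descFactorial_mem_fallingSpan 0)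
  convert! this using 1
  ext x
  simp

/-- Error terms involve absolute values of polynomials, which need not be polynomials; a polynomial
majorant keeps their means computable. -/
lemma exists_abs_le_of_mem_fallingSpan {f : ℕ → ℝ} (hf : f ∈ fallingSpan) :
    ∃ F ∈ fallingSpan, ∀ x, |f x| ≤ F x := by
  induction hf using Submodule.span_induction with
  | mem f hf =>
    obtain ⟨n, rfl⟩ := hf
    exact ⟨_, descFactorial_mem_fallingSpan n, fun x => (abs_of_nonneg (Nat.cast_nonneg _)).le⟩
  | zero => exact ⟨0, fallingSpan.zero_mem, fun x => by simp⟩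
  | add f g _ _ hf hg =>
    obtain ⟨F, hF, h1⟩ := hf
    obtain ⟨G, hG, h2⟩ := hg
    exact ⟨F + G, fallingSpan.add_mem hF hG, fun x =>
      (abs_add_le _ _).trans (add_le_add (h1 x) (h2 x))⟩
  | smul c f _ hf =>
    obtain ⟨F, hF, h1⟩ := hf
    refine ⟨|c| • F, fallingSpan.smul_mem _ hF, fun x => ?_⟩
    simp only [Pi.smul_apply, smul_eq_mul, abs_mul]
    exact mul_le_mul_of_nonneg_left (h1 x) (abs_nonneg c)

lemma sum_range_descFactorial (n x : ℕ) :
    ((n : ℝ) + 1) * ∑ y ∈ Finset.range x, (y.descFactorial n : ℝ) =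
      (x.descFactorial (n + 1) : ℝ) := by
  induction x with
  | zero => simp
  | succ x ih =>
    rw [Finset.sum_range_succ, mul_add, ih]
    have : (x + 1).descFactorial (n + 1) =
        x.descFactorial (n + 1) + (n + 1) * x.descFactorial n := by
      rw [Nat.succ_descFactorial_succ, Nat.descFactorial_succ]
      rcases lt_or_ge x n with h | h
      · simp [Nat.descFactorial_of_lt h]
      · rw [← add_mul]; congr 1; omega
    rw [this]
    push_cast
    ring

/-- Summation raises a falling factorial by one degree, by the hockey-stick identity. It inverts the
difference operator in Newton interpolation. -/
lemma sum_range_mem_fallingSpan {f : ℕ → ℝ} (hf : f ∈ fallingSpan) :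
    (fun x => ∑ y ∈ Finset.range x, f y) ∈ fallingSpan := by
  induction hf using Submodule.span_induction with
  | mem f hf =>
    obtain ⟨n, rfl⟩ := hf
    have h := fallingSpan.smul_mem ((n : ℝ) + 1)⁻¹ (descFactorial_mem_fallingSpan (n + 1))
    convert! h using 1
    ext x
    have : (n : ℝ) + 1 ≠ 0 := by positivity
    simp only [Pi.smul_apply, smul_eq_mul, ← sum_range_descFactorial]
    rw [inv_mul_cancel_left₀ this]
  | zero =>
    convert! fallingSpan.zero_mem using 1
    ext x
    simp
  | add f g _ _ hf hg =>
    convert! fallingSpan.add_mem hf hg using 1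
    ext x
    simp [Finset.sum_add_distrib]
  | smul c f _ hf =>
    convert! fallingSpan.smul_mem c hf using 1
    ext x
    simp [Finset.mul_sum]

/-- Newton interpolation of a bounded function. -/
lemma exists_newton_approx (L : ℕ) : ∀ (f : ℕ → ℝ) (B : ℝ), (∀ x, |f x| ≤ B) →
    ∃ p ∈ fallingSpan, ∀ x : ℕ, |f x - p x| ≤ 2 ^ L * B / L.factorial * x.descFactorial L := by
  induction L with
  | zero =>
    intro f B hf
    exact ⟨0, fallingSpan.zero_mem, fun x => by simpa using hf x⟩
  | succ L ih =>
    intro f B hf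
    -- The induction is applied to the first difference, bounded by `2 * B`, which produces the
    -- factor `2 ^ L`; summing the approximation back contributes the new factor of the factorial.
    obtain ⟨p, hp, h⟩ := ih (fun x => f (x + 1) - f x) (2 * B) fun x =>
      (abs_sub _ _).trans (by linarith [hf x, hf (x + 1)])
    refine ⟨(fun _ => f 0) + fun x => ∑ y ∈ Finset.range x, p y,
      fallingSpan.add_mem (const_mem_fallingSpan _) (sum_range_mem_fallingSpan hp), fun x => ?_⟩
    have h1 : f x - ((fun _ : ℕ => f 0) + fun x : ℕ => ∑ y ∈ Finset.range x, p y) x =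
        ∑ y ∈ Finset.range x, ((f (y + 1) - f y) - p y) := by
      rw [Finset.sum_sub_distrib, Finset.sum_range_sub]
      simp only [Pi.add_apply]
      ring
    rw [h1]
    refine (Finset.abs_sum_le_sum_abs _ _).trans ((Finset.sum_le_sum fun y _ => h y).trans ?_)
    rw [← Finset.mul_sum, ← sum_range_descFactorial, Nat.factorial_succ]
    refine le_of_eq ?_
    have : (L.factorial : ℝ) ≠ 0 := by positivity
    push_cast
    field_simp
    ring

lemma hasSum_poisson_descFactorial (l : ℝ≥0) (n : ℕ) :
    HasSum (fun k : ℕ => Real.exp (-l) * (l : ℝ) ^ k / (k.factorial : ℝ) * (k.descFactorial n : ℝ))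
      ((l : ℝ) ^ n) := by
  -- The terms with `k < n` vanish; after the shift by `n` the series is `l ^ n` times the total
  -- Poisson mass.
  rw [← hasSum_nat_add_iff' n, Finset.sum_eq_zero, sub_zero]
  · have h := (hasSum_one_poissonMeasure l).mul_left ((l : ℝ) ^ n)
    rw [mul_one] at h
    convert! h using 1
    ext k
    rw [← Nat.factorial_mul_descFactorial (Nat.le_add_left n k), Nat.add_sub_cancel, pow_add]
    have h1 : (k.factorial : ℝ) ≠ 0 := by positivity
    have h2 : (((k + n).descFactorial n : ℕ) : ℝ) ≠ 0 := by
      rw [Nat.cast_ne_zero, Ne, Nat.descFactorial_eq_zero_iff_lt]; omega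
    push_cast
    field_simp
  · intro k hk
    rw [Nat.descFactorial_of_lt (Finset.mem_range.1 hk)]
    simp

lemma integrable_poisson_descFactorial (l : ℝ≥0) (n : ℕ) :
    MeasureTheory.Integrable (fun k : ℕ => (k.descFactorial n : ℝ)) (poissonMeasure l) := by
  rw [integrable_poissonMeasure_iff]
  simp_rw [Real.norm_natCast]
  exact (hasSum_poisson_descFactorial l n).summable

lemma integral_poisson_descFactorial (l : ℝ≥0) (n : ℕ) :
    ∫ k : ℕ, (k.descFactorial n : ℝ) ∂poissonMeasure l = (l : ℝ) ^ n := by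
  rw [integral_poissonMeasure]
  simp_rw [smul_eq_mul]
  exact (hasSum_poisson_descFactorial l n).tsum_eq

lemma integrable_poisson_of_mem_fallingSpan (l : ℝ≥0) {f : ℕ → ℝ} (hf : f ∈ fallingSpan) :
    MeasureTheory.Integrable f (poissonMeasure l) := by
  induction hf using Submodule.span_induction with
  | mem f hf =>
    obtain ⟨n, rfl⟩ := hf
    exact integrable_poisson_descFactorial l n
  | zero => exact MeasureTheory.integrable_zero _ _ _
  | add f g _ _ hf hg => exact hf.add hg
  | smul c f _ hf => exact hf.smul c

lemma integrable_poisson_of_bounded (l : ℝ≥0) {f : ℕ → ℝ} {B : ℝ} (hf : ∀ x, |f x| ≤ B) :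
    MeasureTheory.Integrable f (poissonMeasure l) :=
  MeasureTheory.Integrable.of_bound MeasureTheory.AEStronglyMeasurable.of_discrete B
    (Eventually.of_forall hf)

/-! ### Limits of cycle counts -/

/-- Functions that converge to a constant in mean. -/
def TendstoInMean (θ κ : ℕ → ℝ) (X : (N : ℕ) → Equiv.Perm (Fin N) → ℝ) (c : ℝ) : Prop :=
  Tendsto (fun N => expect θ κ N fun σ => |X N σ - c|) atTop (𝓝 0)

namespace SaddlePoint

variable {θ κ : ℕ → ℝ} {r : ℝ}

lemma eventually_partSum_self_pos (h : SaddlePoint θ κ r) :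
    ∀ᶠ N : ℕ in atTop, 0 < partSum (cycleParam θ κ N) N := by
  simpa using h.eventually_partSum_pos 0

lemma tendsto_expect_const (h : SaddlePoint θ κ r) (c : ℝ) :
    Tendsto (fun N : ℕ => expect θ κ N fun _ => c) atTop (𝓝 c) := by
  refine tendsto_const_nhds.congr' ?_
  filter_upwards [h.eventually_partSum_self_pos] with N hN
  rw [expect_const hN]

lemma tendsto_ratio_self (h : SaddlePoint θ κ r) (i : ℕ) :
    Tendsto (fun N : ℕ => partSum (cycleParam θ κ N) (N - i) / partSum (cycleParam θ κ N) N) atTop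
      (𝓝 (r ^ i)) := by
  simpa using h.tendsto_partSum_ratio i 0

/-- Normalized joint factorial moments. -/
theorem tendsto_normalized_moments (h : SaddlePoint θ κ r) (T : Finset ℕ) (hT : ∀ j ∈ T, 1 ≤ j)
    (n : ℕ → ℕ) :
    Tendsto (fun N : ℕ => ((N : ℝ) ^ (∑ j ∈ T, n j))⁻¹ *
      expect θ κ N (fun σ => ∏ j ∈ T, ((cycleCount j σ).descFactorial (n j) : ℝ)))
      atTop (𝓝 (∏ j ∈ T, (κ j * r ^ j / j) ^ n j)) := by
  have h1 : Tendsto (fun N : ℕ => (∏ j ∈ T, (cycleParam θ κ N j / N) ^ n j) *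
      (partSum (cycleParam θ κ N) (N - ∑ j ∈ T, n j * j) / partSum (cycleParam θ κ N) N)) atTop
      (𝓝 ((∏ j ∈ T, (κ j / j) ^ n j) * r ^ (∑ j ∈ T, n j * j))) :=
    (tendsto_finsetProd _ fun j _ => (tendsto_cycleParam_div θ κ j).pow _).mul
      (h.tendsto_ratio_self _)
  have h2 : (∏ j ∈ T, (κ j / j) ^ n j) * r ^ (∑ j ∈ T, n j * j) =
      ∏ j ∈ T, (κ j * r ^ j / j) ^ n j := by
    rw [← Finset.prod_pow_eq_pow_sum, ← Finset.prod_mul_distrib]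
    refine Finset.prod_congr rfl fun j _ => ?_
    rw [mul_comm (n j) j, pow_mul, ← mul_pow]
    congr 1
    ring
  rw [h2] at h1
  refine h1.congr' ?_
  filter_upwards [eventually_ge_atTop (∑ j ∈ T, n j * j)] with N hN
  rw [expect_prod_descFactorial θ κ T hT n N hN, ← mul_assoc, ← Finset.prod_pow_eq_pow_sum,
    ← Finset.prod_inv_distrib, ← Finset.prod_mul_distrib]
  congr 1
  refine Finset.prod_congr rfl fun j _ => ?_
  rw [div_pow]
  ring

/-- Joint factorial moments of cycle counts with `κ_j = 0`. -/
theorem tendsto_moments (h : SaddlePoint θ κ r) (T : Finset ℕ) (hT : ∀ j ∈ T, 1 ≤ j)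
    (hκ : ∀ j ∈ T, κ j = 0) (n : ℕ → ℕ) :
    Tendsto (fun N : ℕ =>
      expect θ κ N (fun σ => ∏ j ∈ T, ((cycleCount j σ).descFactorial (n j) : ℝ)))
      atTop (𝓝 (∏ j ∈ T, (θ j * r ^ j / j) ^ n j)) := by
  have h1 := (h.tendsto_ratio_self (∑ j ∈ T, n j * j)).const_mul (∏ j ∈ T, (θ j / j) ^ n j)
  have h2 : (∏ j ∈ T, (θ j / j) ^ n j) * r ^ (∑ j ∈ T, n j * j) =
      ∏ j ∈ T, (θ j * r ^ j / j) ^ n j := by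
    rw [← Finset.prod_pow_eq_pow_sum, ← Finset.prod_mul_distrib]
    refine Finset.prod_congr rfl fun j _ => ?_
    rw [mul_comm (n j) j, pow_mul, ← mul_pow]
    congr 1
    ring
  rw [h2] at h1
  refine h1.congr' ?_
  filter_upwards [eventually_ge_atTop (∑ j ∈ T, n j * j)] with N hN
  rw [expect_prod_descFactorial θ κ T hT n N hN]
  congr 1
  refine Finset.prod_congr rfl fun j hj => ?_
  rw [cycleParam, hκ j hj, mul_zero, add_zero]

lemma tendsto_moment_one (h : SaddlePoint θ κ r) {j : ℕ} (hj : 1 ≤ j) (n : ℕ) :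
    Tendsto (fun N : ℕ => ((N : ℝ) ^ n)⁻¹ *
      expect θ κ N (fun σ => ((cycleCount j σ).descFactorial n : ℝ)))
      atTop (𝓝 ((κ j * r ^ j / j) ^ n)) := by
  simpa using h.tendsto_normalized_moments {j} (by simpa using hj) fun _ => n

/-- Expanding the square with `C^2 = (C)_2 + C` leaves normalized moments; the term linear in `C`
carries an extra `1/N`, and the limits combine to `c^2 - 2c^2 + c^2 = 0`. -/
lemma tendsto_variance (h : SaddlePoint θ κ r) {j : ℕ} (hj : 1 ≤ j) :
    Tendsto (fun N : ℕ => expect θ κ N fun σ =>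
      ((cycleCount j σ : ℝ) / N - κ j * r ^ j / j) ^ 2) atTop (𝓝 0) := by
  set c := κ j * r ^ j / j with hc
  have m1 := h.tendsto_moment_one hj 1
  have m2 := h.tendsto_moment_one hj 2
  simp only [pow_one, Nat.descFactorial_one] at m1
  have h1 := ((m2.add (m1.mul tendsto_inv_atTop_nhds_zero_nat)).sub (m1.const_mul (2 * c))).add
    (h.tendsto_expect_const (c ^ 2))
  rw [← hc] at h1
  rw [show c ^ 2 + c * 0 - 2 * c * c + c ^ 2 = 0 by ring] at h1
  refine h1.congr fun N => ?_
  rw [mul_right_comm, ← mul_inv, ← sq]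
  simp only [← mul_assoc]
  rw [← expect_const_mul, ← expect_const_mul, ← expect_const_mul, ← expect_add, ← expect_sub,
    ← expect_add]
  congr 1
  ext σ
  have : (((cycleCount j σ).descFactorial 2 : ℕ) : ℝ) =
      (cycleCount j σ : ℝ) * ((cycleCount j σ : ℝ) - 1) := by
    rw [Nat.cast_descFactorial_two]
  rw [this]
  ring

/-- The law of large numbers for cycle counts. -/
theorem tendstoInProb (h : SaddlePoint θ κ r) {j : ℕ} (hj : 1 ≤ j) :
    TendstoInProb θ κ (fun N σ => (cycleCount j σ : ℝ) / N) (κ j * r ^ j / j) := by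
  intro ε hε
  have h1 := (h.tendsto_variance hj).const_mul (ε ^ 2)⁻¹
  rw [mul_zero] at h1
  refine tendsto_of_tendsto_of_tendsto_of_le_of_le tendsto_const_nhds h1
    (fun N => expect_nonneg h.θ_nonneg h.κ_nonneg fun σ =>
      Set.indicator_nonneg (fun _ _ => zero_le_one) σ) fun N => ?_
  simp only
  rw [← expect_const_mul]
  refine expect_mono h.θ_nonneg h.κ_nonneg fun σ => ?_
  refine Set.indicator_apply_le' (fun hσ => ?_) fun _ => by positivity
  have h2 : ε ^ 2 ≤ ((cycleCount j σ : ℝ) / N - κ j * r ^ j / j) ^ 2 := by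
    rw [← sq_abs (_ - _)]
    exact pow_le_pow_left₀ hε.le hσ 2
  rw [inv_mul_eq_div, le_div_iff₀ (by positivity)]
  linarith

lemma tendstoInMean_of_tendstoInProb (h : SaddlePoint θ κ r)
    {X : (N : ℕ) → Equiv.Perm (Fin N) → ℝ} {c : ℝ} (hX : TendstoInProb θ κ X c) (f : ℝ →ᵇ ℝ) :
    TendstoInMean θ κ (fun N σ => f (X N σ)) (f c) := by
  have h0 : ∀ N, 0 ≤ expect θ κ N fun σ => |f (X N σ) - f c| := fun N =>
    expect_nonneg h.θ_nonneg h.κ_nonneg fun σ => abs_nonneg _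
  refine tendsto_order.2 ⟨fun a ha => Eventually.of_forall fun N => ha.trans_le (h0 N),
    fun ε hε => ?_⟩
  obtain ⟨δ, hδ, hf⟩ := Metric.continuousAt_iff.1 (f.continuous.continuousAt (x := c))
    (ε / 2) (half_pos hε)
  have h1 := (h.tendsto_expect_const (ε / 2)).add ((hX δ hδ).const_mul (2 * ‖f‖))
  rw [mul_zero, add_zero] at h1
  filter_upwards [h1.eventually_lt_const (half_lt_self hε)] with N hN
  refine lt_of_le_of_lt ?_ hN
  rw [prob, ← expect_const_mul, ← expect_add]
  refine expect_mono h.θ_nonneg h.κ_nonneg fun σ => ?_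
  by_cases hσ : δ ≤ |X N σ - c|
  · rw [Set.indicator_of_mem (show σ ∈ {σ | δ ≤ |X N σ - c|} from hσ), mul_one]
    have h2 := f.dist_le_two_norm (X N σ) c
    rw [Real.dist_eq] at h2
    linarith
  · rw [Set.indicator_of_notMem (show σ ∉ {σ | δ ≤ |X N σ - c|} from hσ), mul_zero, add_zero]
    have h2 := hf (x := X N σ) (by rw [Real.dist_eq]; exact not_le.1 hσ)
    rw [Real.dist_eq] at h2
    exact h2.le

lemma tendstoInMean_prod (h : SaddlePoint θ κ r) (J : Finset ℕ)
    {X : (N : ℕ) → ℕ → Equiv.Perm (Fin N) → ℝ} {c B : ℕ → ℝ} (hB : ∀ N j σ, |X N j σ| ≤ B j)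
    (hX : ∀ j ∈ J, TendstoInMean θ κ (fun N σ => X N j σ) (c j)) :
    TendstoInMean θ κ (fun N σ => ∏ j ∈ J, X N j σ) (∏ j ∈ J, c j) := by
  classical
  induction J using Finset.induction_on with
  | empty =>
    simp only [TendstoInMean, Finset.prod_empty, sub_self, abs_zero]
    exact h.tendsto_expect_const 0
  | insert i J hi ih =>
    have h1 := (ih fun j hj => hX j (Finset.mem_insert_of_mem hj)).const_mul (B i)
    have h2 := (hX i (Finset.mem_insert_self i J)).const_mul |∏ j ∈ J, c j|
    have h3 := h1.add h2
    rw [mul_zero, mul_zero, add_zero] at h3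
    refine tendsto_of_tendsto_of_tendsto_of_le_of_le tendsto_const_nhds h3
      (fun N => expect_nonneg h.θ_nonneg h.κ_nonneg fun σ => abs_nonneg _) fun N => ?_
    simp only
    rw [← expect_const_mul, ← expect_const_mul, ← expect_add]
    refine expect_mono h.θ_nonneg h.κ_nonneg fun σ => ?_
    rw [Finset.prod_insert hi, Finset.prod_insert hi]
    have e : X N i σ * ∏ j ∈ J, X N j σ - c i * ∏ j ∈ J, c j =
      X N i σ * (∏ j ∈ J, X N j σ - ∏ j ∈ J, c j) + (∏ j ∈ J, c j) * (X N i σ - c i) := by ring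
    rw [e]
    refine (abs_add_le _ _).trans ?_
    rw [abs_mul, abs_mul]
    have := mul_le_mul_of_nonneg_right (hB N i σ) (abs_nonneg (∏ j ∈ J, X N j σ - ∏ j ∈ J, c j))
    linarith

/-- A product of a bounded variable with convergent mean and one converging in mean. -/
lemma tendsto_expect_mul (h : SaddlePoint θ κ r) {X Y : (N : ℕ) → Equiv.Perm (Fin N) → ℝ}
    {x y B : ℝ} (hB : ∀ N σ, |X N σ| ≤ B)
    (hX : Tendsto (fun N => expect θ κ N (X N)) atTop (𝓝 x)) (hY : TendstoInMean θ κ Y y) :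
    Tendsto (fun N => expect θ κ N fun σ => X N σ * Y N σ) atTop (𝓝 (x * y)) := by
  have h1 := hX.mul_const y
  have h2 := hY.const_mul B
  rw [mul_zero] at h2
  have h3 : Tendsto (fun N => (expect θ κ N fun σ => X N σ * Y N σ) - expect θ κ N (X N) * y)
      atTop (𝓝 0) := by
    refine squeeze_zero_norm (fun N => ?_) h2
    rw [mul_comm, ← expect_const_mul, ← expect_const_mul, Real.norm_eq_abs]
    refine abs_expect_sub_le h.θ_nonneg h.κ_nonneg fun σ => ?_
    rw [mul_comm y, ← mul_sub, abs_mul]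
    exact mul_le_mul_of_nonneg_right (hB N σ) (abs_nonneg _)
  simpa using h3.add h1

end SaddlePoint

/-! ### Joint Poisson limits -/

namespace SaddlePoint

variable {θ κ : ℕ → ℝ} {r : ℝ}

/-- The limiting Poisson parameter of `C_j` if `κ_j = 0`. -/
noncomputable def poissonParam (θ : ℕ → ℝ) (r : ℝ) (j : ℕ) : ℝ≥0 := (θ j * r ^ j / j).toNNReal

lemma coe_poissonParam (h : SaddlePoint θ κ r) {j : ℕ} (hj : 1 ≤ j) :
    (poissonParam θ r j : ℝ) = θ j * r ^ j / j :=
  Real.coe_toNNReal _ (div_nonneg (mul_nonneg (h.θ_nonneg j hj) (pow_nonneg h.pos.le j))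
    (Nat.cast_nonneg j))

/-- The mean of `∏_{j ∈ T} f_j(C_j)` tends to the product of the Poisson means. -/
def HasPoissonMeans (θ κ : ℕ → ℝ) (r : ℝ) (T : Finset ℕ) (f : ℕ → ℕ → ℝ) : Prop :=
  Tendsto (fun N : ℕ => expect θ κ N fun σ => ∏ j ∈ T, f j (cycleCount j σ)) atTop
    (𝓝 (∏ j ∈ T, ∫ k : ℕ, f j k ∂poissonMeasure (poissonParam θ r j)))

/-- The functional `F` is abstract so that one identity isolates coordinate `j` both in the product
of functions of cycle counts and in the product of Poisson integrals. -/
lemma prod_update_eq {T : Finset ℕ} {j : ℕ} (hj : j ∈ T) (f : ℕ → ℕ → ℝ) (g : ℕ → ℝ) {β : Type*}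
    (F : ℕ → (ℕ → ℝ) → β → ℝ) (b : β) : ∏ i ∈ T, F i (Function.update f j g i) b =
      F j g b * ∏ i ∈ T.erase j, F i (f i) b := by
  rw [← Finset.mul_prod_erase _ _ hj, Function.update_self]
  congr 1
  refine Finset.prod_congr rfl fun i hi => ?_
  rw [Function.update_of_ne (Finset.ne_of_mem_erase hi)]

lemma hasPoissonMeans_update_iff {T : Finset ℕ} {j : ℕ} (hj : j ∈ T) (f : ℕ → ℕ → ℝ) (g : ℕ → ℝ) :
    HasPoissonMeans θ κ r T (Function.update f j g) ↔
      Tendsto (fun N : ℕ => expect θ κ N fun σ =>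
        g (cycleCount j σ) * ∏ i ∈ T.erase j, f i (cycleCount i σ)) atTop
      (𝓝 ((∫ k : ℕ, g k ∂poissonMeasure (poissonParam θ r j)) *
        ∏ i ∈ T.erase j, ∫ k : ℕ, f i k ∂poissonMeasure (poissonParam θ r i))) := by
  have h1 := fun N (σ : Equiv.Perm (Fin N)) =>
    prod_update_eq hj f g (fun i u σ => u (cycleCount i σ)) σ
  have h2 := prod_update_eq hj f g
    (fun i u (_ : Unit) => ∫ k : ℕ, u k ∂poissonMeasure (poissonParam θ r i)) ()
  unfold HasPoissonMeans
  rw [h2]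
  simp_rw [h1]

lemma HasPoissonMeans.congr {T : Finset ℕ} {f g : ℕ → ℕ → ℝ} (hf : HasPoissonMeans θ κ r T f)
    (hfg : ∀ j ∈ T, f j = g j) : HasPoissonMeans θ κ r T g := by
  have h1 : ∀ N : ℕ, (expect θ κ N fun σ => ∏ j ∈ T, g j (cycleCount j σ)) =
      expect θ κ N fun σ => ∏ j ∈ T, f j (cycleCount j σ) := fun N => by
    congr 1
    ext σ
    exact Finset.prod_congr rfl fun j hj => by rw [hfg j hj]
  have h2 : ∏ j ∈ T, ∫ k : ℕ, g j k ∂poissonMeasure (poissonParam θ r j) =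
      ∏ j ∈ T, ∫ k : ℕ, f j k ∂poissonMeasure (poissonParam θ r j) :=
    Finset.prod_congr rfl fun j hj => by rw [hfg j hj]
  unfold HasPoissonMeans
  simp_rw [h1, h2]
  exact hf

/-- Both sides are linear in each `f j`, so the coordinates are extended one at a time from falling
factorials to their span; the base case is the convergence of joint factorial moments. -/
lemma hasPoissonMeans_of_mem_fallingSpan (h : SaddlePoint θ κ r) {T : Finset ℕ}
    (hT : ∀ j ∈ T, 1 ≤ j) (hκ : ∀ j ∈ T, κ j = 0) (f : ℕ → ℕ → ℝ) (hf : ∀ j, f j ∈ fallingSpan) :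
    HasPoissonMeans θ κ r T f := by
  classical
  suffices H : ∀ J : Finset ℕ, J ⊆ T → ∀ f : ℕ → ℕ → ℝ, (∀ j ∈ J, f j ∈ fallingSpan) →
      (∀ j, j ∉ J → ∃ n : ℕ, f j = fun x => (x.descFactorial n : ℝ)) →
      HasPoissonMeans θ κ r T f by
    have h1 := H T subset_rfl
      -- Outside `T` the functions do not matter; they are set to `(x)_0 = 1` to meet the
      -- requirement on the coordinates off `J`.
      (fun j => if j ∈ T then f j else fun x => (x.descFactorial 0 : ℝ))
      (fun j hj => by simpa only [if_pos hj] using hf j) fun j hj => ⟨0, if_neg hj⟩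
    exact h1.congr fun j hj => if_pos hj
  intro J
  induction J using Finset.induction_on with
  | empty =>
    intro _ f _ hf
    choose n hn using fun j => hf j (Finset.notMem_empty j)
    have h1 := h.tendsto_moments T hT hκ n
    unfold HasPoissonMeans
    simp_rw [hn, integral_poisson_descFactorial]
    rw [Finset.prod_congr rfl fun j hj => by rw [h.coe_poissonParam (hT j hj)]]
    exact h1
  | insert j J hj ih =>
    intro hJ f hf1 hf2
    have hjT : j ∈ T := hJ (Finset.mem_insert_self j J)
    rw [← Function.update_eq_self j f]
    have hfj := hf1 j (Finset.mem_insert_self j J)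
    generalize f j = g at hfj
    induction hfj using Submodule.span_induction with
    | mem g hg =>
      obtain ⟨n, rfl⟩ := hg
      refine ih ((Finset.subset_insert j J).trans hJ) _ (fun i hi => ?_) fun i hi => ?_
      · rw [Function.update_of_ne (ne_of_mem_of_not_mem hi hj)]
        exact hf1 i (Finset.mem_insert_of_mem hi)
      · by_cases hij : i = j
        · subst hij
          exact ⟨n, Function.update_self _ _ _⟩
        · rw [Function.update_of_ne hij]
          exact hf2 i (by simp [hij, hi])
    | zero =>
      rw [hasPoissonMeans_update_iff hjT]
      simp [expect]
    | add u v hu hv hu' hv' =>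
      rw [hasPoissonMeans_update_iff hjT] at hu' hv' ⊢
      have h1 := hu'.add hv'
      simp_rw [← expect_add, ← add_mul] at h1
      simp_rw [Pi.add_apply]
      rwa [MeasureTheory.integral_add (integrable_poisson_of_mem_fallingSpan _ hu)
        (integrable_poisson_of_mem_fallingSpan _ hv)]
    | smul c u hu hu' =>
      rw [hasPoissonMeans_update_iff hjT] at hu' ⊢
      have h1 := hu'.const_mul c
      simp_rw [← expect_const_mul, ← mul_assoc] at h1
      simp_rw [Pi.smul_apply, smul_eq_mul]
      rwa [MeasureTheory.integral_const_mul]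

lemma tendsto_newton_remainder (l B : ℝ) :
    Tendsto (fun L : ℕ => 2 ^ L * B / L.factorial * l ^ L) atTop (𝓝 0) := by
  have := (FloorSemiring.tendsto_pow_div_factorial_atTop (2 * l)).const_mul B
  rw [mul_zero] at this
  refine this.congr fun L => ?_
  rw [mul_pow]
  ring

/-- Polynomials are replaced by bounded functions one coordinate at a time. A Newton approximation
of order `L` has error at most `2^L B / L!` times `(C_j)_L`. Multiplied by polynomial majorants of
the other factors, its mean tends to a multiple of `2^L B l^L / L!`, which is small for large `L`.
-/
lemma hasPoissonMeans_of_bounded (h : SaddlePoint θ κ r) {T : Finset ℕ}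
    (hT : ∀ j ∈ T, 1 ≤ j) (hκ : ∀ j ∈ T, κ j = 0) (f : ℕ → ℕ → ℝ) {B : ℝ}
    (hf : ∀ j x, |f j x| ≤ B) : HasPoissonMeans θ κ r T f := by
  classical
  have hB : 0 ≤ B := (abs_nonneg _).trans (hf 0 0)
  suffices H : ∀ J : Finset ℕ, J ⊆ T → ∀ f : ℕ → ℕ → ℝ, (∀ j ∈ J, ∀ x, |f j x| ≤ B) →
      (∀ j, j ∉ J → f j ∈ fallingSpan) → HasPoissonMeans θ κ r T f by
    have h1 := H T subset_rfl (fun j => if j ∈ T then f j else 0)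
      (fun j hj => by simpa only [if_pos hj] using hf j) fun j hj => by
        simp only [if_neg hj]; exact fallingSpan.zero_mem
    exact h1.congr fun j hj => if_pos hj
  intro J
  induction J using Finset.induction_on with
  | empty =>
    exact fun _ f _ hf => h.hasPoissonMeans_of_mem_fallingSpan hT hκ f fun j => hf j (by simp)
  | insert j J hj ih =>
    intro hJ f hf1 hf2
    have hjT : j ∈ T := hJ (Finset.mem_insert_self j J)
    -- The majorants bound coordinates already bounded by a constant and those still polynomial
    -- alike, so the mean of the error term falls under the polynomial case.
    have hdom : ∀ i, ∃ F ∈ fallingSpan, ∀ x, |f i x| ≤ F x := fun i => by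
      by_cases hi : i ∈ insert j J
      · exact ⟨_, const_mem_fallingSpan B, hf1 i hi⟩
      · exact exists_abs_le_of_mem_fallingSpan (hf2 i hi)
    choose F hF hfF using hdom
    have hfj := hf1 j (Finset.mem_insert_self j J)
    choose p hp hpf using fun L => exists_newton_approx L (f j) B hfj
    set l := poissonParam θ r j
    set A := ∏ i ∈ T.erase j, ∫ k : ℕ, f i k ∂poissonMeasure (poissonParam θ r i) with hA
    set A' := ∏ i ∈ T.erase j, ∫ k : ℕ, F i k ∂poissonMeasure (poissonParam θ r i) with hA'
    set R : ℕ → ℝ := fun L => 2 ^ L * B / L.factorial with hR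
    have hR0 : ∀ L, 0 ≤ R L := fun L => by positivity
    have hpoly : ∀ L, Tendsto (fun N : ℕ => expect θ κ N fun σ =>
        p L (cycleCount j σ) * ∏ i ∈ T.erase j, f i (cycleCount i σ)) atTop
        (𝓝 ((∫ k : ℕ, p L k ∂poissonMeasure l) * A)) := fun L => by
      rw [← hasPoissonMeans_update_iff hjT]
      refine ih ((Finset.subset_insert j J).trans hJ) _ (fun i hi => ?_) fun i hi => ?_
      · rw [Function.update_of_ne (ne_of_mem_of_not_mem hi hj)]
        exact hf1 i (Finset.mem_insert_of_mem hi)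
      · by_cases hij : i = j
        · subst hij
          rw [Function.update_self]
          exact hp L
        · rw [Function.update_of_ne hij]
          exact hf2 i (by simp [hij, hi])
    have herr : ∀ L, Tendsto (fun N : ℕ => expect θ κ N fun σ =>
        R L * ((cycleCount j σ).descFactorial L : ℝ) * ∏ i ∈ T.erase j, F i (cycleCount i σ)) atTop
        (𝓝 (R L * (l : ℝ) ^ L * A')) := fun L => by
      have h1 := h.hasPoissonMeans_of_mem_fallingSpan hT hκ
        (Function.update F j fun x => (x.descFactorial L : ℝ)) fun i => by
          by_cases hij : i = j
          · subst hij
            rw [Function.update_self]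
            exact descFactorial_mem_fallingSpan L
          · rw [Function.update_of_ne hij]
            exact hF i
      rw [hasPoissonMeans_update_iff hjT, integral_poisson_descFactorial] at h1
      have h2 := h1.const_mul (R L)
      simp_rw [← expect_const_mul, ← mul_assoc] at h2
      exact h2
    have hint : ∀ L, |(∫ k : ℕ, p L k ∂poissonMeasure l) - ∫ k : ℕ, f j k ∂poissonMeasure l| ≤
        R L * (l : ℝ) ^ L := fun L => by
      have i1 := integrable_poisson_of_mem_fallingSpan l (hp L)
      have i2 := integrable_poisson_of_bounded l hfj
      rw [← MeasureTheory.integral_sub i1 i2, ← integral_poisson_descFactorial,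
        ← MeasureTheory.integral_const_mul]
      refine MeasureTheory.abs_integral_le_integral_abs.trans
        (MeasureTheory.integral_mono (i1.sub i2).abs
          ((integrable_poisson_descFactorial l L).const_mul _) fun x => ?_)
      simp only
      rw [abs_sub_comm]
      exact hpf L x
    rw [← Function.update_eq_self j f, hasPoissonMeans_update_iff hjT]
    rw [Metric.tendsto_atTop']
    intro ε hε
    have hsmall := (tendsto_newton_remainder (l : ℝ) B).mul_const (A' + |A|)
    rw [zero_mul] at hsmall
    -- `L` is fixed before `N`: it controls both the error in the expectation, through `A'`, and
    -- that in the limit, through `|A|`.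
    obtain ⟨L, hL⟩ := (hsmall.eventually_lt_const (show 0 < ε / 2 by positivity)).exists
    have hsum := (herr L).add ((hpoly L).sub_const ((∫ k : ℕ, p L k ∂poissonMeasure l) * A)).abs
    rw [sub_self, abs_zero, add_zero] at hsum
    have hlt : R L * (l : ℝ) ^ L * A' < ε - R L * (l : ℝ) ^ L * |A| := by
      have : R L * (l : ℝ) ^ L * (A' + |A|) < ε / 2 := hL
      linarith
    obtain ⟨n, hn⟩ := eventually_atTop.1 (hsum.eventually_lt_const hlt)
    refine ⟨n, fun N hN => ?_⟩
    have h1 := hn N hN.le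
    have h2 : |(expect θ κ N fun σ =>
        f j (cycleCount j σ) * ∏ i ∈ T.erase j, f i (cycleCount i σ)) -
        expect θ κ N fun σ => p L (cycleCount j σ) * ∏ i ∈ T.erase j, f i (cycleCount i σ)| ≤
        expect θ κ N fun σ => R L * ((cycleCount j σ).descFactorial L : ℝ) *
          ∏ i ∈ T.erase j, F i (cycleCount i σ) := by
      refine abs_expect_sub_le h.θ_nonneg h.κ_nonneg fun σ => ?_
      rw [← sub_mul, abs_mul, Finset.abs_prod]
      exact mul_le_mul (hpf L _) (Finset.prod_le_prod (fun i _ => abs_nonneg _) fun i _ => hfF i _)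
        (Finset.prod_nonneg fun i _ => abs_nonneg _) (mul_nonneg (hR0 L) (Nat.cast_nonneg _))
    have h3 : |(∫ k : ℕ, p L k ∂poissonMeasure l) * A - (∫ k : ℕ, f j k ∂poissonMeasure l) * A| ≤
        R L * (l : ℝ) ^ L * |A| := by
      rw [← sub_mul, abs_mul]
      exact mul_le_mul_of_nonneg_right (hint L) (abs_nonneg A)
    rw [Real.dist_eq]
    have tri : ∀ a b c d : ℝ, |a - d| ≤ |a - b| + |b - c| + |c - d| := fun a b c d =>
      (abs_sub_le a c d).trans (add_le_add_left (abs_sub_le a b c) _)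
    exact ((tri _ _ _ _).trans (add_le_add (add_le_add h2 le_rfl) h3)).trans_lt (by linarith)

open Classical in
/-- The joint limit law of cycle counts, normalized outside of `U`. -/
theorem tendsto_expect_prod (h : SaddlePoint θ κ r) {U : Set ℕ} (hU : ∀ j ∈ U, κ j = 0)
    (J : Finset ℕ) (hJ : ∀ j ∈ J, 1 ≤ j) (f : ℕ → ℝ →ᵇ ℝ) :
    Tendsto (fun N : ℕ => expect θ κ N fun σ => ∏ j ∈ J, f j (if j ∈ U then (cycleCount j σ : ℝ)
      else (cycleCount j σ : ℝ) / N)) atTop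
      (𝓝 (∏ j ∈ J, if j ∈ U then ∫ k : ℕ, f j k ∂poissonMeasure (poissonParam θ r j)
        else f j (κ j * r ^ j / j))) := by
  set B := ∑ j ∈ J, ‖f j‖ with hB
  have hfB : ∀ j ∈ J, ∀ x, |f j x| ≤ B := fun j hj x =>
    ((f j).norm_coe_le_norm x).trans
      (Finset.single_le_sum (f := fun j => ‖f j‖) (fun i _ => norm_nonneg _) hj)
  have hB0 : 0 ≤ B := Finset.sum_nonneg fun i _ => norm_nonneg _
  set J1 := J.filter (· ∈ U) with hJ1
  set J2 := J.filter (· ∉ U) with hJ2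
  have hpois : Tendsto (fun N : ℕ => expect θ κ N fun σ => ∏ j ∈ J1, f j (cycleCount j σ : ℝ)) atTop
      (𝓝 (∏ j ∈ J1, ∫ k : ℕ, f j k ∂poissonMeasure (poissonParam θ r j))) := by
    -- The functions are cut to zero outside `J` so that `B` bounds them for every index.
    have h1 := h.hasPoissonMeans_of_bounded (T := J1)
      (fun j hj => hJ j (Finset.mem_filter.1 hj).1) (fun j hj => hU j (Finset.mem_filter.1 hj).2)
      (fun j x => if j ∈ J then f j x else 0) (B := B) fun j x => by
        split_ifs with hj
        · exact hfB j hj _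
        · simpa using hB0
    exact h1.congr (g := fun j x => f j (x : ℝ)) fun j hj => by
      simp only [if_pos (Finset.mem_filter.1 hj).1]
  have hmean : TendstoInMean θ κ (fun N σ => ∏ j ∈ J2, f j ((cycleCount j σ : ℝ) / N))
      (∏ j ∈ J2, f j (κ j * r ^ j / j)) :=
    h.tendstoInMean_prod J2 (X := fun N j σ => f j ((cycleCount j σ : ℝ) / N))
      (B := fun j => ‖f j‖) (fun N j σ => (f j).norm_coe_le_norm _) fun j hj =>
        h.tendstoInMean_of_tendstoInProb
          (h.tendstoInProb (hJ j (Finset.mem_filter.1 hj).1)) (f j)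
  have hprod := h.tendsto_expect_mul (B := ∏ j ∈ J1, B) (fun N σ => by
    rw [Finset.abs_prod]
    exact Finset.prod_le_prod (fun j _ => abs_nonneg _) fun j hj =>
      hfB j (Finset.mem_filter.1 hj).1 _) hpois hmean
  have hsplit : ∀ a b : ℕ → ℝ, (∏ j ∈ J, if j ∈ U then a j else b j) =
      (∏ j ∈ J1, a j) * ∏ j ∈ J2, b j := fun a b => Finset.prod_ite _ _
  rw [hsplit]
  simp_rw [apply_ite (f _), hsplit]
  exact hprod

open Classical in
theorem asympIndep (h : SaddlePoint θ κ r) {U : Set ℕ} (hU : ∀ j ∈ U, κ j = 0) :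
    AsympIndep θ κ (fun N j σ => if j ∈ U then (cycleCount j σ : ℝ)
      else (cycleCount j σ : ℝ) / N) := by
  intro J hJ f
  have h1 := h.tendsto_expect_prod hU J hJ f
  have h2 := tendsto_finsetProd J fun j hj =>
    h.tendsto_expect_prod hU {j} (by simpa using hJ j hj) f
  simp_rw [Finset.prod_singleton] at h2
  have h3 := h1.sub h2
  rwa [sub_self] at h3

theorem tendstoPoisson (h : SaddlePoint θ κ r) {j : ℕ} (hj : 1 ≤ j) (hκ : κ j = 0) :
    TendstoPoisson θ κ (fun _ σ => (cycleCount j σ : ℝ)) (θ j * r ^ j / j).toNNReal := by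
  intro f
  have h1 := h.tendsto_expect_prod (U := {j}) (by simpa using hκ) {j} (by simpa using hj) fun _ => f
  simpa [Finset.prod_singleton, poissonParam] using h1

end SaddlePoint

/-! ### The point `r_*` -/

/-- These two facts, common to the six regimes, allow a uniform treatment in terms of `r_*`. -/
lemma Admissible.radius_pos_and_le {θ κ : ℕ → ℝ} (h : Admissible θ κ) :
    0 < radius κ ∧ radius κ ≤ radius θ := by
  rcases h with h | h | h | h | h | h
  · exact ⟨h.1, h.2.1⟩
  · obtain ⟨R, η, φ, θs, δ, Gθ, Gκ, hR, hrad, -, -, -, -, -, -, hθ, -⟩ := h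
    exact ⟨hrad ▸ ENNReal.ofReal_pos.2 hR, hrad ▸ hθ.le_radius⟩
  · obtain ⟨R, η, φ, s, as, δ, Gθ, Gκ, hR, hrad, -, -, -, -, -, -, -, -, -, -, hθ, -⟩ := h
    exact ⟨hrad ▸ ENNReal.ofReal_pos.2 hR, hrad ▸ hθ.le_radius⟩
  · obtain ⟨R, hR, hrad, hθ, -⟩ := h
    exact ⟨hrad ▸ ENNReal.ofReal_pos.2 hR, hrad ▸ hθ⟩
  · obtain ⟨R, η, φ, θs, δ, Gθ, Gκ, hR, hrad, -, -, -, -, -, -, -, -, hθ, -⟩ := h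
    exact ⟨hrad ▸ ENNReal.ofReal_pos.2 hR, hrad ▸ hθ.le_radius⟩
  · obtain ⟨R, η, φ, θs, s, as, δ, Gθ, Gκ, hR, hrad, -, -, -, -, -, -, -, -, -, hθ, -⟩ := h
    exact ⟨hrad ▸ ENNReal.ofReal_pos.2 hR, hrad ▸ hθ.le_radius⟩

section RStar

variable {κ : ℕ → ℝ}

lemma mul_div_nonneg (hκ : ∀ j, 1 ≤ j → 0 ≤ κ j) (j : ℕ) : 0 ≤ (j : ℝ) * (κ j / j) :=
  mul_nonneg (Nat.cast_nonneg j) (div_nonneg_of_forall_pos hκ j)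

lemma modDeriv_one_ofReal (hκ : ∀ j, 1 ≤ j → 0 ≤ κ j) {r : ℝ} (hr : 0 ≤ r) :
    modDeriv κ 1 (ENNReal.ofReal r) =
      ∑' j : ℕ, ENNReal.ofReal ((j : ℝ) * (κ j / j) * r ^ j) := by
  refine tsum_congr fun j => ?_
  rw [Nat.descFactorial_one, ← ENNReal.ofReal_pow hr,
    ← ENNReal.ofReal_mul (mul_div_nonneg hκ j)]

lemma hasSum_of_modDeriv_ne_top (hκ : ∀ j, 1 ≤ j → 0 ≤ κ j) {r : ℝ} (hr : 0 ≤ r)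
    (h : modDeriv κ 1 (ENNReal.ofReal r) ≠ ∞) :
    HasSum (fun j : ℕ => (j : ℝ) * (κ j / j) * r ^ j) (modDeriv κ 1 (ENNReal.ofReal r)).toReal := by
  have h0 : ∀ j : ℕ, 0 ≤ (j : ℝ) * (κ j / j) * r ^ j := fun j =>
    mul_nonneg (mul_div_nonneg hκ j) (pow_nonneg hr j)
  rw [modDeriv_one_ofReal hκ hr] at h ⊢
  have h1 := ENNReal.hasSum_toReal h
  rw [ENNReal.tsum_toReal_eq fun j => ENNReal.ofReal_ne_top]
  simpa only [ENNReal.toReal_ofReal (h0 _)] using h1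

lemma modDeriv_one_lt_modDeriv_one (hκ : ∀ j, 1 ≤ j → 0 ≤ κ j) {j₀ : ℕ} (hj₀ : 1 ≤ j₀)
    (hpos : 0 < κ j₀) {r s : ℝ} (hr : 0 ≤ r) (hrs : r < s)
    (h : modDeriv κ 1 (ENNReal.ofReal r) ≠ ∞) :
    modDeriv κ 1 (ENNReal.ofReal r) < modDeriv κ 1 (ENNReal.ofReal s) := by
  have hs : 0 < s := hr.trans_lt hrs
  rw [modDeriv_one_ofReal hκ hr] at h ⊢
  rw [modDeriv_one_ofReal hκ hs.le]
  refine ENNReal.tsum_lt_tsum (i := j₀) h (fun j => ENNReal.ofReal_le_ofReal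
    (mul_le_mul_of_nonneg_left (pow_le_pow_left₀ hr hrs.le j) (mul_div_nonneg hκ j))) ?_
  have hj : (0 : ℝ) < j₀ := by exact_mod_cast hj₀
  have hc : 0 < (j₀ : ℝ) * (κ j₀ / j₀) := by positivity
  rw [ENNReal.ofReal_lt_ofReal_iff (by positivity)]
  exact mul_lt_mul_of_pos_left (pow_lt_pow_left₀ hrs hr (by omega)) hc

lemma summable_of_lt_radius {a : ℕ → ℝ} {r : ℝ} (hr : 0 ≤ r)
    (h : ENNReal.ofReal r < radius a) : Summable fun j : ℕ => |a j / j| * r ^ j := by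
  have := FormalMultilinearSeries.summable_norm_mul_pow
    (FormalMultilinearSeries.ofScalars ℂ fun j : ℕ => ((a j / j : ℝ) : ℂ)) h
  refine this.congr fun j => ?_
  rw [FormalMultilinearSeries.ofScalars_norm, Complex.norm_real, Real.coe_toNNReal r hr,
    Real.norm_eq_abs]

lemma summable_mul_of_lt_radius {r : ℝ} (hr : 0 ≤ r) (hκ : ∀ j, 1 ≤ j → 0 ≤ κ j)
    (h : ENNReal.ofReal r < radius κ) : Summable fun j : ℕ => (j : ℝ) * (κ j / j) * r ^ j := by
  obtain ⟨a, ha, C, hC, hle⟩ := FormalMultilinearSeries.norm_mul_pow_le_mul_pow_of_lt_radius _ h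
  have h1 : Summable fun j : ℕ => C * ((j : ℝ) ^ 1 * a ^ j) :=
    (summable_pow_mul_geometric_of_norm_lt_one 1
      (by rw [Real.norm_eq_abs, abs_of_pos ha.1]; exact ha.2)).mul_left C
  refine Summable.of_nonneg_of_le (fun j => mul_nonneg (mul_div_nonneg hκ j) (pow_nonneg hr j))
    (fun j => ?_) h1
  have h2 := hle j
  rw [FormalMultilinearSeries.ofScalars_norm, Complex.norm_real, Real.coe_toNNReal r hr,
    Real.norm_eq_abs, abs_of_nonneg (div_nonneg_of_forall_pos hκ j)] at h2
  have := mul_le_mul_of_nonneg_left h2 (Nat.cast_nonneg (α := ℝ) j)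
  calc (j : ℝ) * (κ j / j) * r ^ j = j * (κ j / j * r ^ j) := by ring
    _ ≤ j * (C * a ^ j) := this
    _ = _ := by ring

/-- The series is the supremum of its partial sums, and one of them already exceeds 1 at the radius.
It is continuous on `[0, ∞]`, hence exceeds 1 slightly below, also when the radius is infinite. -/
lemma exists_lt_radius_one_lt (h0 : 0 < radius κ) (h : 1 < modDeriv κ 1 (radius κ)) :
    ∃ x : ℝ≥0∞, x < radius κ ∧ 1 < modDeriv κ 1 x := by
  unfold modDeriv at h
  rw [ENNReal.tsum_eq_iSup_sum, lt_iSup_iff] at h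
  obtain ⟨s, hs⟩ := h
  have hcont : Continuous fun x : ℝ≥0∞ =>
      ∑ j ∈ s, ENNReal.ofReal ((j.descFactorial 1 : ℝ) * (κ j / j)) * x ^ j :=
    continuous_finsetSum _ fun j _ =>
      (ENNReal.continuous_const_mul ENNReal.ofReal_ne_top).comp (ENNReal.continuous_pow j)
  have hev := (hcont.tendsto (radius κ)).eventually_const_lt hs
  have : (𝓝[<] radius κ).NeBot := nhdsLT_neBot_of_exists_lt ⟨0, h0⟩
  obtain ⟨x, hx, hx1⟩ := ((hev.filter_mono nhdsWithin_le_nhds).and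
    (self_mem_nhdsWithin (s := Set.Iio (radius κ)))).exists
  exact ⟨x, hx1, hx.trans_le (ENNReal.sum_le_tsum s)⟩

/-- The intermediate value theorem is applied on `[0, s]` with `s` strictly inside the radius, where
the series converges uniformly. -/
lemma exists_root (hκ : ∀ j, 1 ≤ j → 0 ≤ κ j) (h0 : 0 < radius κ)
    (h : 1 < modDeriv κ 1 (radius κ)) :
    ∃ r : ℝ, 0 < r ∧ ENNReal.ofReal r ≤ radius κ ∧ modDeriv κ 1 (ENNReal.ofReal r) = 1 := by
  obtain ⟨x, hx, hx1⟩ := exists_lt_radius_one_lt h0 h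
  set s := x.toReal with hs
  have hxs : ENNReal.ofReal s = x := ENNReal.ofReal_toReal hx.ne_top
  have hs0 : 0 ≤ s := ENNReal.toReal_nonneg
  have hsum := summable_mul_of_lt_radius hs0 hκ (hxs ▸ hx)
  set f : ℝ → ℝ := fun r => ∑' j : ℕ, (j : ℝ) * (κ j / j) * r ^ j with hf
  have hfr : ∀ r, 0 ≤ r → r ≤ s → modDeriv κ 1 (ENNReal.ofReal r) = ENNReal.ofReal (f r) := by
    intro r hr hrs
    rw [modDeriv_one_ofReal hκ hr, hf, ENNReal.ofReal_tsum_of_nonneg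
      fun j => mul_nonneg (mul_div_nonneg hκ j) (pow_nonneg hr j)]
    refine Summable.of_nonneg_of_le (fun j => mul_nonneg (mul_div_nonneg hκ j) (pow_nonneg hr j))
      (fun j => ?_) hsum
    exact mul_le_mul_of_nonneg_left (pow_le_pow_left₀ hr hrs j) (mul_div_nonneg hκ j)
  have hcont : ContinuousOn f (Set.Icc 0 s) := by
    refine continuousOn_tsum (fun j => by fun_prop) hsum fun j r hr => ?_
    rw [Real.norm_eq_abs, abs_of_nonneg (mul_nonneg (mul_div_nonneg hκ j) (pow_nonneg hr.1 j))]
    exact mul_le_mul_of_nonneg_left (pow_le_pow_left₀ hr.1 hr.2 j) (mul_div_nonneg hκ j)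
  have hf0 : f 0 = 0 := by
    rw [hf]
    refine (tsum_congr fun j => ?_).trans tsum_zero
    rcases Nat.eq_zero_or_pos j with rfl | hj
    · simp
    · rw [zero_pow hj.ne', mul_zero]
  have hfs : 1 < f s := by
    rw [← hxs, hfr s hs0 le_rfl, ENNReal.one_lt_ofReal] at hx1
    exact hx1
  obtain ⟨r, hr, hr1⟩ := intermediate_value_Icc hs0 hcont
    (show (1 : ℝ) ∈ Set.Icc (f 0) (f s) from ⟨by rw [hf0]; exact zero_le_one, hfs.le⟩)
  refine ⟨r, lt_of_le_of_ne hr.1 fun e => ?_, ?_, ?_⟩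
  · rw [← e, hf0] at hr1
    exact zero_ne_one hr1
  · exact (ENNReal.ofReal_le_ofReal hr.2).trans (hxs ▸ hx.le)
  · rw [hfr r hr.1 hr.2, hr1, ENNReal.ofReal_one]

theorem existsUnique_isRStar (hκ : ∀ j, 1 ≤ j → 0 ≤ κ j) (hpos : ∃ j : ℕ, 1 ≤ j ∧ 0 < κ j)
    (h0 : 0 < radius κ) : ∃! r : ℝ, IsRStar κ r := by
  obtain ⟨j, hj, hjκ⟩ := hpos
  refine existsUnique_of_exists_of_unique ?_ fun r s hr hs => ?_
  · rcases lt_or_ge 1 (modDeriv κ 1 (radius κ)) with h | h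
    · obtain ⟨r, hr0, hrR, hr1⟩ := exists_root hκ h0 h
      exact ⟨r, hr0, hrR, fun _ => hr1, fun h' => absurd h (not_lt.2 h')⟩
    -- If the radius were infinite, the single term with `κ j > 0` would be infinite there,
    -- contradicting the bound by 1.
    · have htop : radius κ ≠ ∞ := fun e => by
        have hj0 : (0 : ℝ) < j := by exact_mod_cast hj
        have h1 := (ENNReal.le_tsum (f := fun j : ℕ =>
          ENNReal.ofReal ((j.descFactorial 1 : ℝ) * (κ j / j)) * radius κ ^ j) j).trans h
        rw [e, ENNReal.top_pow (by omega), Nat.descFactorial_one, ENNReal.mul_top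
          (ENNReal.ofReal_pos.2 (by positivity)).ne'] at h1
        exact absurd h1 (by simp)
      have hR := ENNReal.ofReal_toReal htop
      exact ⟨(radius κ).toReal, ENNReal.toReal_pos h0.ne' htop, hR.le,
        fun h' => by rw [hR]; exact le_antisymm h h', fun _ => hR⟩
  · rcases le_total 1 (modDeriv κ 1 (radius κ)) with h | h
    · have h1 := hr.root h
      have h2 := hs.root h
      rcases lt_trichotomy r s with hlt | heq | hlt
      · have := modDeriv_one_lt_modDeriv_one hκ hj hjκ hr.pos.le hlt (by rw [h1]; simp)
        rw [h1, h2] at this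
        exact absurd this (lt_irrefl _)
      · exact heq
      · have := modDeriv_one_lt_modDeriv_one hκ hj hjκ hs.pos.le hlt (by rw [h2]; simp)
        rw [h1, h2] at this
        exact absurd this (lt_irrefl _)
    · have := (hr.boundary h).trans (hs.boundary h).symm
      rwa [ENNReal.ofReal_eq_ofReal_iff hr.pos.le hs.pos.le] at this

/-- At the radius of convergence, `κ_j r^j` does not decay exponentially. -/
lemma exists_neg_log_le_of_radius_eq (hκ : ∀ j, 1 ≤ j → 0 ≤ κ j) {r : ℝ} (hr : 0 < r)
    (hR : ENNReal.ofReal r = radius κ) {ε : ℝ} (hε : 0 < ε) :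
    ∃ j : ℕ, 1 ≤ j ∧ 0 < κ j ∧ -Real.log (κ j * r ^ j) ≤ ε * j := by
  by_contra! hcon
  have hbound : ∀ j : ℕ, κ j / j * (r * Real.exp ε) ^ j ≤ 1 := fun j => by
    rcases Nat.eq_zero_or_pos j with rfl | hj
    · simp
    · have hj1 : (1 : ℝ) ≤ j := by exact_mod_cast hj
      rcases (hκ j hj).eq_or_lt with h | h
      · rw [← h]; simp
      · have h1 := hcon j hj h
        have h2 : κ j * r ^ j ≤ Real.exp (-(ε * j)) := by
          rw [← Real.log_le_iff_le_exp (mul_pos h (pow_pos hr j))]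
          linarith
        have h3 : Real.exp ε ^ j = Real.exp (ε * j) := by rw [← Real.exp_nat_mul, mul_comm]
        calc κ j / j * (r * Real.exp ε) ^ j ≤ κ j * (r * Real.exp ε) ^ j := by
              refine mul_le_mul_of_nonneg_right (div_le_self h.le hj1) (by positivity)
          _ = κ j * r ^ j * Real.exp (ε * j) := by rw [mul_pow, h3, mul_assoc]
          _ ≤ Real.exp (-(ε * j)) * Real.exp (ε * j) := by gcongr
          _ = 1 := by rw [← Real.exp_add]; simp
  have hle : ENNReal.ofReal (r * Real.exp ε) ≤ radius κ := by
    refine FormalMultilinearSeries.le_radius_of_bound _ 1 fun j => ?_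
    rw [FormalMultilinearSeries.ofScalars_norm, Complex.norm_real,
      Real.coe_toNNReal _ (by positivity), Real.norm_eq_abs,
      abs_of_nonneg (div_nonneg_of_forall_pos hκ j)]
    exact hbound j
  rw [← hR, ENNReal.ofReal_le_ofReal_iff hr.le] at hle
  have := Real.add_one_lt_exp hε.ne'
  nlinarith

end RStar

/-- The filling condition has two sources. If `g_κ^{1}(R) ≥ 1`, then `m = 1` and any index in the
support works. Otherwise `r = R`, and the definition of the radius of convergence supplies indices
at which `κ_j r^j` is not exponentially small. -/
theorem IsRStar.saddlePoint {θ κ : ℕ → ℝ} {r : ℝ} (h : IsRStar κ r)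
    (hθ : ∀ j : ℕ, 1 ≤ j → 0 ≤ θ j) (hκ : ∀ j : ℕ, 1 ≤ j → 0 ≤ κ j)
    (hNA : NonArithmetic κ) (hrad : radius κ ≤ radius θ) : SaddlePoint θ κ r := by
  obtain ⟨i, hi2, hi⟩ := hNA.nondegenerate
  have hF1 : modDeriv κ 1 (ENNReal.ofReal r) ≤ 1 := by
    rcases le_total 1 (modDeriv κ 1 (radius κ)) with h1 | h1
    · exact (h.root h1).le
    · rw [h.boundary h1]; exact h1
  have hFtop : modDeriv κ 1 (ENNReal.ofReal r) ≠ ∞ := (hF1.trans_lt ENNReal.one_lt_top).ne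
  refine ⟨hθ, hκ, h.pos, ⟨_, ?_, hasSum_of_modDeriv_ne_top hκ h.pos.le hFtop, fun ε hε => ?_⟩,
    fun d hd => ?_, fun ρ hρ hρr => ?_⟩
  · exact ENNReal.toReal_le_of_le_ofReal zero_le_one (by simpa using hF1)
  · rcases lt_or_ge (modDeriv κ 1 (radius κ)) 1 with h1 | h1
    · have hm0 : (0 : ℝ) ≤ (modDeriv κ 1 (ENNReal.ofReal r)).toReal := ENNReal.toReal_nonneg
      have hm1 : (modDeriv κ 1 (ENNReal.ofReal r)).toReal ≤ 1 :=
        ENNReal.toReal_le_of_le_ofReal zero_le_one (by simpa using hF1)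
      obtain ⟨j, hj, hjκ, hle⟩ := exists_neg_log_le_of_radius_eq hκ h.pos (h.boundary h1.le) hε
      refine ⟨j, hj, hjκ, ?_⟩
      have hεj : 0 ≤ ε * j := mul_nonneg hε.le (Nat.cast_nonneg j)
      refine (mul_le_mul_of_nonneg_left hle (by linarith)).trans ?_
      exact mul_le_of_le_one_left hεj (by linarith)
    · refine ⟨i, by omega, hi, ?_⟩
      rw [h.root h1, ENNReal.toReal_one, sub_self, zero_mul]
      positivity
  · by_contra hd1
    -- The gcd condition also quantifies over `d = 0`, which is excluded because it would divide
    -- only `0`.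
    rcases Nat.eq_zero_or_pos d with rfl | hd0
    · have := Nat.eq_zero_of_zero_dvd (hd i (by omega) hi)
      omega
    · exact hNA.nonArith ⟨d, by omega, fun j hj hne => hd j hj (lt_of_le_of_ne (hκ j hj) hne.symm)⟩
  · have hlt : ENNReal.ofReal ρ < radius θ :=
      (((ENNReal.ofReal_lt_ofReal_iff h.pos).2 hρr).trans_le h.le_radius).trans_le hrad
    refine (summable_of_lt_radius hρ.le hlt).congr fun j => ?_
    rw [abs_of_nonneg (div_nonneg_of_forall_pos hθ j)]

end SurrogateSpatial

/-! ### Assembly of the main theorem. -/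

theorem mainTheorem5 (θ κ : ℕ → ℝ)
    (hθ : ∀ j : ℕ, 1 ≤ j → 0 ≤ θ j) (hκ : ∀ j : ℕ, 1 ≤ j → 0 ≤ κ j)
    (hNA : SurrogateSpatial.NonArithmetic κ)
    (hadm : SurrogateSpatial.Admissible θ κ) :
    (∃! r : ℝ, SurrogateSpatial.IsRStar κ r) ∧
    ∀ r : ℝ, SurrogateSpatial.IsRStar κ r →
      -- (a) normalized factorial moments
      (∀ (m : ℕ) (n : ℕ → ℕ),
        Tendsto (fun N : ℕ => ((N : ℝ) ^ (∑ j ∈ Finset.Icc 1 m, n j))⁻¹ *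
            SurrogateSpatial.expect θ κ N (fun σ => ∏ j ∈ Finset.Icc 1 m,
              ((SurrogateSpatial.cycleCount j σ).descFactorial (n j) : ℝ)))
          atTop (𝓝 (∏ j ∈ Finset.Icc 1 m, (κ j * r ^ j / j) ^ n j))) ∧
      -- (a) asymptotic independence and convergence in probability of the normalized counts
      SurrogateSpatial.AsympIndep θ κ
        (fun N j σ => (SurrogateSpatial.cycleCount j σ : ℝ) / N) ∧
      (∀ j : ℕ, 1 ≤ j → SurrogateSpatial.TendstoInProb θ κ
        (fun N σ => (SurrogateSpatial.cycleCount j σ : ℝ) / N) (κ j * r ^ j / j)) ∧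
      -- (b) factorial moments and Poisson limit
      (∀ j : ℕ, 1 ≤ j → κ j = 0 → 0 < θ j →
        (∀ n : ℕ, Tendsto (fun N : ℕ => SurrogateSpatial.expect θ κ N
            (fun σ => ((SurrogateSpatial.cycleCount j σ).descFactorial n : ℝ)))
          atTop (𝓝 ((θ j * r ^ j / j) ^ n))) ∧
        SurrogateSpatial.TendstoPoisson θ κ
          (fun N σ => (SurrogateSpatial.cycleCount j σ : ℝ)) (θ j * r ^ j / j).toNNReal) ∧
      -- (b) asymptotic independence, where counts `C_j` with `j ∈ U` are not normalized
      (∀ U : Set ℕ, (∀ j ∈ U, κ j = 0) →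
        SurrogateSpatial.AsympIndep θ κ (fun N j σ =>
          open Classical in
          if j ∈ U then (SurrogateSpatial.cycleCount j σ : ℝ)
          else (SurrogateSpatial.cycleCount j σ : ℝ) / N)) := by
  obtain ⟨h0, hrad⟩ := hadm.radius_pos_and_le
  obtain ⟨i, hi2, hi⟩ := hNA.nondegenerate
  refine ⟨SurrogateSpatial.existsUnique_isRStar hκ ⟨i, by omega, hi⟩ h0, fun r hr => ?_⟩
  have h := hr.saddlePoint hθ hκ hNA hrad
  refine ⟨fun m n => h.tendsto_normalized_moments _ (fun j hj => (Finset.mem_Icc.1 hj).1) n, ?_,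
    fun j hj => h.tendstoInProb hj, fun j hj hκj _ => ⟨fun n => ?_, h.tendstoPoisson hj hκj⟩,
    fun U hU => h.asympIndep hU⟩
  · simpa using h.asympIndep (U := ∅) (by simp)
  · simpa using h.tendsto_moments {j} (by simpa using hj) (by simpa using hκj) fun _ => n
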